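/- Let $G$ be a finite two-player game with nonempty finite sets of pure strategies $S_1,S_2$ of sizes $m_1,m_2$ and real payoffs. For a mixed strategy $\sigma\in\Delta(S_{-i})$ of the opponent let $BR_i(\sigma)\subset S_i$ be the set of pure best replies of player $i$. Fix a sample size $k\ge 1$ and a recency parameter $\beta\in(0,1)$, and let $\varepsilon\in[0,1]$ be an error probability. The recency weighted sampler (RWS) is the Markov chain on $\square(S)=\Delta(S_1)\times\Delta(S_2)$ which moves from $(p_1,p_2)$ to $$\bigl(\beta p_1+(1-\beta)\mathbf 1_{s_1},\ \beta p_2+(1-\beta)\mathbf 1_{s_2}\bigr),$$ where $\mathbf 1_{s}$ is the unit vector of the pure strategy $s$, and $s_1,s_2$ are chosen independently as follows: player $i$ draws $k$ independent pure strategies of the opponent from $p_{-i}$ and forms their empirical distribution $D_{-i}$; with probability $1-\varepsilon$ she takes $s_i$ uniformly at random from $BR_i(D_{-i})$, and with probability $\varepsilon$ uniformly at random from $S_i$. A block $C=C_1\times C_2$ with nonempty $C_i\subset S_i$ is called a CURB block (relative to the sample size $k$) if, for $i=1,2$, $BR_i(\sigma)\subset C_i$ for every $\sigma\in\Delta(S_{-i})$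 with support in $C_{-i}$ all of whose weights are integer multiples of $1/k$; it is minimal if it contains no strictly smaller CURB block. For $\delta>0$ put $$B_\delta(C_1\times C_2)=\Bigl\{(p_1,p_2)\in\square(S):\ \sum_{s\in C_i}p_{i,s}\ge 1-\delta,\ i=1,2\Bigr\},$$ and, for the union $\mathscr C$ of all minimal CURB blocks, let $B_\delta(\mathscr C)=\bigcup_C B_\delta(C)$, the union over all minimal CURB blocks $C$. **Theorem.** Assume $\beta\in\bigl(1-\tfrac1{\max\{m_1,m_2\}},\,1\bigr)$. For every $\varepsilon\in(0,1]$ the RWS has exactly one invariant Borel probability measure $\mu^*_\varepsilon$ on $\square(S)$, and for every $\delta>0$ $$\lim_{\varepsilon\downarrow 0}\mu^*_\varepsilon\bigl(B_\delta(\mathscr C)\bigr)=1 .$$ -/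

import Mathlib

open MeasureTheory ProbabilityTheory

namespace RWS

/-! ### Best replies, for one player with action set `A` facing an opponent with action set `B`.
`π a b` is the player's payoff when she plays `a` and the opponent plays `b`. -/

/-- Expected payoff of the pure action `a` against the mixed strategy `σ`. -/
def expectedPayoff {A B : Type*} [Fintype B] (π : A → B → ℝ) (a : A) (σ : B → ℝ) : ℝ :=
  ∑ b, σ b * π a b

/-- The set `BR(σ)` of pure best replies to the mixed strategy `σ`. -/
noncomputable def bestReplies {A B : Type*} [Fintype A] [Fintype B] (π : A → B → ℝ)
    (σ : B → ℝ) : Finset A :=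
  Finset.univ.filter fun a => ∀ a', expectedPayoff π a' σ ≤ expectedPayoff π a σ

/-- The unit vector of the pure strategy `s`. -/
def unitVec {A : Type*} [DecidableEq A] (s : A) : A → ℝ := fun a => if a = s then 1 else 0

/-- The empirical distribution `D` of a sample `ω` of `k` opponent actions. -/
noncomputable def empirical {B : Type*} [DecidableEq B] {k : ℕ} (ω : Fin k → B) : B → ℝ :=
  fun b => (1 / (k : ℝ)) * ∑ j, unitVec (ω j) b

/-- The probability that the player, after `k` independent draws of opponent actions from `p`,
selects `a` when choosing uniformly among the best replies to the empirical distribution. -/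
noncomputable def bestReplyProb {A B : Type*} [Fintype A] [DecidableEq A] [Fintype B]
    [DecidableEq B] (π : A → B → ℝ) (k : ℕ) (p : stdSimplex ℝ B) (a : A) : ℝ :=
  ∑ ω : Fin k → B, (∏ j, p.1 (ω j)) *
    (if a ∈ bestReplies π (empirical ω)
      then 1 / ((bestReplies π (empirical ω)).card : ℝ) else 0)

/-- The probability that the player finally plays `a`, when with probability `ε` she errs and
plays a uniformly random action instead. -/
noncomputable def playProb {A B : Type*} [Fintype A] [DecidableEq A] [Fintype B]
    [DecidableEq B] (π : A → B → ℝ) (k : ℕ) (ε : ℝ) (p : stdSimplex ℝ B) (a : A) : ℝ :=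
  (1 - ε) * bestReplyProb π k p a + ε / (Fintype.card A : ℝ)

/-! ### The Markov chain -/

/-- The state space: pairs of mixed strategies. -/
abbrev State (S₁ S₂ : Type*) [Fintype S₁] [Fintype S₂] : Type _ :=
  stdSimplex ℝ S₁ × stdSimplex ℝ S₂

/-- The updated historical distribution `β p + (1 - β) 1_s` after the action `s` is played. -/
noncomputable def update {A : Type*} [Fintype A] [DecidableEq A] (β : unitInterval)
    (p : stdSimplex ℝ A) (s : A) : stdSimplex ℝ A :=
  ⟨fun a => (β : ℝ) * p.1 a + (1 - (β : ℝ)) * unitVec s a, by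
    refine ⟨fun a => ?_, ?_⟩
    · have h1 := p.2.1 a
      have h2 : (0 : ℝ) ≤ unitVec s a := by unfold unitVec; split_ifs <;> norm_num
      exact add_nonneg (mul_nonneg β.2.1 h1) (mul_nonneg (sub_nonneg.2 β.2.2) h2)
    · rw [Finset.sum_add_distrib, ← Finset.mul_sum, ← Finset.mul_sum, p.2.2]
      simp [unitVec]⟩

section Kernel

variable {S₁ S₂ : Type*} [Fintype S₁] [DecidableEq S₁] [Fintype S₂] [DecidableEq S₂]

/-- The law of the next state given the state `p = (p₁, p₂)`: the players choose independently,
player 1 reacting to `p₂` and player 2 to `p₁`. Both payoff functions take the player's own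
action first. -/
noncomputable def transition (u₁ : S₁ → S₂ → ℝ) (u₂ : S₂ → S₁ → ℝ) (k : ℕ) (β : unitInterval)
    (ε : ℝ) (p : State S₁ S₂) : Measure (State S₁ S₂) :=
  ∑ s₁ : S₁, ∑ s₂ : S₂,
    ENNReal.ofReal (playProb u₁ k ε p.2 s₁ * playProb u₂ k ε p.1 s₂) •
      Measure.dirac (update β p.1 s₁, update β p.2 s₂)

theorem measurable_playProb {A B : Type*} [Fintype A] [DecidableEq A] [Fintype B]
    [DecidableEq B] (π : A → B → ℝ) (k : ℕ) (ε : ℝ) (a : A) :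
    Measurable fun p : stdSimplex ℝ B => playProb π k ε p a := by
  unfold playProb bestReplyProb
  refine Measurable.add_const (Measurable.const_mul ?_ _) _
  refine Finset.measurable_sum _ fun ω _ => Measurable.mul_const ?_ _
  exact Finset.measurable_prod _ fun j _ => (measurable_pi_apply (ω j)).comp measurable_subtype_coe

theorem measurable_update {A : Type*} [Fintype A] [DecidableEq A] (β : unitInterval) (s : A) :
    Measurable fun p : stdSimplex ℝ A => update β p s := by
  refine Measurable.subtype_mk (measurable_pi_lambda _ fun a => ?_)
  exact Measurable.add_const
    (((measurable_pi_apply a).comp measurable_subtype_coe).const_mul _) _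

theorem measurable_transition (u₁ : S₁ → S₂ → ℝ) (u₂ : S₂ → S₁ → ℝ) (k : ℕ)
    (β : unitInterval) (ε : ℝ) : Measurable (transition u₁ u₂ k β ε) := by
  refine Measure.measurable_of_measurable_coe _ fun B hB => ?_
  simp only [transition, Measure.finsetSum_apply, Measure.smul_apply, smul_eq_mul]
  refine Finset.measurable_sum _ fun s₁ _ => Finset.measurable_sum _ fun s₂ _ => ?_
  refine Measurable.mul (ENNReal.measurable_ofReal.comp
    (((measurable_playProb u₁ k ε s₁).comp measurable_snd).mul
      ((measurable_playProb u₂ k ε s₂).comp measurable_fst))) ?_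
  exact (Measure.measurable_coe hB).comp (Measure.measurable_dirac.comp
    (((measurable_update β s₁).comp measurable_fst).prodMk
      ((measurable_update β s₂).comp measurable_snd)))

/-- The transition kernel `P` of the recency weighted sampler. -/
noncomputable def kernel (u₁ : S₁ → S₂ → ℝ) (u₂ : S₂ → S₁ → ℝ) (k : ℕ) (β : unitInterval)
    (ε : ℝ) : Kernel (State S₁ S₂) (State S₁ S₂) :=
  ⟨transition u₁ u₂ k β ε, measurable_transition u₁ u₂ k β ε⟩

/-! ### CURB blocks -/

/-- The mixed strategies with support in `C` that lie on the `k`-lattice, i.e. whose weights are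
multiples of `1 / k`. -/
def lattice {B : Type*} [Fintype B] (k : ℕ) (C : Finset B) : Set (B → ℝ) :=
  {σ | (∃ n : B → ℕ, ∑ b, n b = k ∧ ∀ b, σ b = (n b : ℝ) / (k : ℝ)) ∧ ∀ b, b ∉ C → σ b = 0}

/-- `C = C₁ × C₂` is a `k`-CURB block: it is nonempty and contains all best replies to mixed
strategies on the `k`-lattice with support in the block. -/
def IsCurb (u₁ : S₁ → S₂ → ℝ) (u₂ : S₂ → S₁ → ℝ) (k : ℕ) (C : Finset S₁ × Finset S₂) : Prop :=
  C.1.Nonempty ∧ C.2.Nonempty ∧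
    (∀ σ ∈ lattice k C.2, bestReplies u₁ σ ⊆ C.1) ∧
    (∀ σ ∈ lattice k C.1, bestReplies u₂ σ ⊆ C.2)

/-- A `k`-CURB block that contains no strictly smaller one (blocks are ordered by inclusion in
each component). -/
def IsMinCurb (u₁ : S₁ → S₂ → ℝ) (u₂ : S₂ → S₁ → ℝ) (k : ℕ)
    (C : Finset S₁ × Finset S₂) : Prop :=
  Minimal (IsCurb u₁ u₂ k) C

/-- The neighbourhood `B_δ(C₁ × C₂)` of a block. -/
def blockNhd (δ : ℝ) (C : Finset S₁ × Finset S₂) : Set (State S₁ S₂) :=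
  {p | 1 - δ ≤ ∑ s ∈ C.1, p.1.1 s ∧ 1 - δ ≤ ∑ s ∈ C.2, p.2.1 s}

/-- The neighbourhood of the union of the minimal CURB blocks: the states that are in the
neighbourhood of one of them. -/
def minCurbNhd (u₁ : S₁ → S₂ → ℝ) (u₂ : S₂ → S₁ → ℝ) (k : ℕ) (δ : ℝ) : Set (State S₁ S₂) :=
  ⋃ C ∈ {C | IsMinCurb u₁ u₂ k C}, blockNhd δ C

end Kernel

end RWS

/-! The chain is an iterated function system: each pure profile `s` acts by the map `jointUpdate β
s`, which contracts distances by `β`, and is chosen with a probability that is Lipschitz in the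
state. For `ε > 0` every profile has probability bounded below. Two copies of the chain can then
share their maps for `n` steps with positive probability, and the oscillation of the iterates of a
Lipschitz function tends to `0` (`exists_markovOp_iterate_sub_le`). With compactness this gives
existence and uniqueness of the invariant measure (`exists_forall_invariant_iff`).

For the limit, let `V` be the `potential`: the mass outside the nearest minimal CURB block, scaled
by `M` and capped at `1`. For the error-free chain two facts hold. Near a block `C`, a sample leaves
`C` with probability at most `k` times the outside mass, while play inside `C` multiplies that mass
by `β`. For large `M` this makes `V` superharmonic, and contracted by a factor `γ < 1` wherever `V <
1` (`samplerOp_potential_le`). From any state, best replies to samples from a growing set of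
well-represented actions lead, with probability bounded below, to a CURB block and then close to a
minimal one (`exists_samplerOp_iterate_potential_le`). Together they give `N` and `θ < 1` such that
the `N`-step operator maps `V` below `θ * V`. Errors change `N` steps by at most a constant times
`ε`, so integrating against an invariant measure gives `(1 - θ) ∫ V ≤ const * ε`. Markov's
inequality finishes the proof. -/

open Filter Topology

namespace RWS

/-! ### Markov operators of iterated function systems: Lipschitz bounds, coupling, decay of
oscillation. -/

section MarkovOp

variable {ι X : Type*} [Fintype ι]

/-- The Markov operator of the chain that moves from `x` to `T i x` with probability `q i x`. -/
def markovOp (q : ι → X → ℝ) (T : ι → X → X) (f : X → ℝ) : X → ℝ :=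
  fun x => ∑ i, q i x * f (T i x)

/-- The functions `q i` are the weights of a probability distribution on `ι`. -/
structure IsWeight (q : ι → X → ℝ) : Prop where
  nonneg : ∀ i x, 0 ≤ q i x
  sum_eq_one : ∀ x, ∑ i, q i x = 1

variable {q : ι → X → ℝ} {T : ι → X → X}

theorem markovOp_mono (hq : IsWeight q) {f g : X → ℝ} (h : ∀ x, f x ≤ g x) (x : X) :
    markovOp q T f x ≤ markovOp q T g x :=
  Finset.sum_le_sum fun i _ => mul_le_mul_of_nonneg_left (h _) (hq.nonneg i x)

theorem markovOp_add_const (hq : IsWeight q) (f : X → ℝ) (c : ℝ) (x : X) :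
    markovOp q T (fun y => f y + c) x = markovOp q T f x + c := by
  simp only [markovOp, mul_add, Finset.sum_add_distrib, ← Finset.sum_mul, hq.sum_eq_one, one_mul]

theorem markovOp_const (hq : IsWeight q) (c : ℝ) (x : X) :
    markovOp q T (fun _ => c) x = c := by
  simp only [markovOp, ← Finset.sum_mul, hq.sum_eq_one, one_mul]

theorem markovOp_iterate_mono (hq : IsWeight q) {f g : X → ℝ} (h : ∀ x, f x ≤ g x) (n : ℕ) :
    ∀ x, (markovOp q T)^[n] f x ≤ (markovOp q T)^[n] g x := by
  induction n with
  | zero => exact h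
  | succ n ih =>
    intro x
    rw [Function.iterate_succ_apply', Function.iterate_succ_apply']
    exact markovOp_mono hq ih x

theorem continuous_markovOp [TopologicalSpace X] (hq : ∀ i, Continuous (q i))
    (hT : ∀ i, Continuous (T i)) {f : X → ℝ} (hf : Continuous f) :
    Continuous (markovOp q T f) :=
  continuous_finsetSum _ fun i _ => (hq i).mul (hf.comp (hT i))

theorem continuous_markovOp_iterate [TopologicalSpace X] (hq : ∀ i, Continuous (q i))
    (hT : ∀ i, Continuous (T i)) {f : X → ℝ} (hf : Continuous f) (n : ℕ) :
    Continuous ((markovOp q T)^[n] f) := by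
  induction n with
  | zero => exact hf
  | succ n ih =>
    rw [Function.iterate_succ_apply']
    exact continuous_markovOp hq hT ih

/-- Both sums are compared with `c` times the minimum of `v`; the two weights need only have the
same total mass. -/
theorem sum_mul_sub_sum_mul_le {a b u v : ι → ℝ} {c o : ℝ} (ha : ∀ i, 0 ≤ a i)
    (hb : ∀ i, 0 ≤ b i) (hac : ∑ i, a i = c) (hbc : ∑ i, b i = c)
    (h : ∀ i j, u i - v j ≤ o) : ∑ i, a i * u i - ∑ i, b i * v i ≤ c * o := by
  rcases isEmpty_or_nonempty ι with hι | hι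
  · simp at hac
    simp [← hac]
  obtain ⟨j, -, hj⟩ := Finset.exists_min_image Finset.univ v Finset.univ_nonempty
  have h1 : ∑ i, a i * u i ≤ c * (v j + o) := by
    rw [← hac, Finset.sum_mul]
    exact Finset.sum_le_sum fun i _ =>
      mul_le_mul_of_nonneg_left (by linarith [h i j]) (ha i)
  have h2 : c * v j ≤ ∑ i, b i * v i := by
    rw [← hbc, Finset.sum_mul]
    exact Finset.sum_le_sum fun i hi => mul_le_mul_of_nonneg_left (hj i hi) (hb i)
  linarith

theorem markovOp_sub_le (hq : IsWeight q) {f : X → ℝ} {o : ℝ} (ho : ∀ x y, f x - f y ≤ o)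
    (x y : X) : markovOp q T f x - markovOp q T f y ≤ o := by
  simpa [markovOp] using sum_mul_sub_sum_mul_le (hq.nonneg · x) (hq.nonneg · y) (hq.sum_eq_one x)
    (hq.sum_eq_one y) fun i j => ho (T i x) (T j y)

theorem markovOp_iterate_sub_le (hq : IsWeight q) {f : X → ℝ} {o : ℝ}
    (ho : ∀ x y, f x - f y ≤ o) (n : ℕ) :
    ∀ x y, (markovOp q T)^[n] f x - (markovOp q T)^[n] f y ≤ o := by
  induction n with
  | zero => exact ho
  | succ n ih =>
    intro x y
    rw [Function.iterate_succ_apply']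
    exact markovOp_sub_le hq ih x y

/-- Two copies of the chain can be coupled so that they use the same map with probability at
least `θ`. -/
theorem markovOp_sub_le_of_le [Nonempty ι] (hq : IsWeight q) {f : X → ℝ} {θ r o : ℝ}
    (hθ : ∀ i x, θ ≤ Fintype.card ι * q i x) (ho : ∀ x y, f x - f y ≤ o) (x y : X)
    (hr : ∀ i, f (T i x) - f (T i y) ≤ r) (hθ0 : 0 ≤ θ) :
    markovOp q T f x - markovOp q T f y ≤ θ * r + (1 - θ) * o := by
  have hc : (0 : ℝ) < Fintype.card ι := by exact_mod_cast Fintype.card_pos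
  -- A share `c` is split off from every weight. On these shares, of total mass `θ`, both copies use
  -- the same map; the remaining mass `1 - θ` is controlled only by the oscillation.
  set c : ℝ := θ / Fintype.card ι with hcdef
  have hcc : (Fintype.card ι : ℝ) * c = θ := by rw [hcdef]; field_simp
  have hcq : ∀ i x, 0 ≤ q i x - c := fun i x => by
    rw [sub_nonneg, hcdef, div_le_iff₀ hc, mul_comm]; exact hθ i x
  have hs : ∀ x, ∑ i, (q i x - c) = 1 - θ := fun x => by
    rw [Finset.sum_sub_distrib, hq.sum_eq_one, Finset.sum_const, Finset.card_univ,
      nsmul_eq_mul, hcc]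
  have h1 := sum_mul_sub_sum_mul_le (hcq · x) (hcq · y) (hs x) (hs y)
    fun i j => ho (T i x) (T j y)
  have h2 : ∑ i, c * (f (T i x) - f (T i y)) ≤ θ * r := by
    refine (Finset.sum_le_sum fun i _ =>
      mul_le_mul_of_nonneg_left (hr i) (by positivity)).trans_eq ?_
    rw [Finset.sum_const, Finset.card_univ, nsmul_eq_mul, ← mul_assoc, hcc]
  have h3 : markovOp q T f x - markovOp q T f y = ∑ i, c * (f (T i x) - f (T i y)) +
      (∑ i, (q i x - c) * f (T i x) - ∑ i, (q i y - c) * f (T i y)) := by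
    simp only [markovOp, ← Finset.sum_sub_distrib, ← Finset.sum_add_distrib]
    exact Finset.sum_congr rfl fun i _ => by ring
  linarith

variable [PseudoMetricSpace X]

/-- Moving the point inside `f` costs `b * K`. Moving it in the weights costs only the oscillation
`o`, not the size of `f`: the differences of weights sum to zero, so `f` may be recentred at `f y`.
-/
theorem markovOp_sub_le_mul_dist (hq : IsWeight q) {b L K o : ℝ}
    (hT : ∀ i x y, dist (T i x) (T i y) ≤ b * dist x y)
    (hL : ∀ i x y, |q i x - q i y| ≤ L * dist x y) {f : X → ℝ}
    (hK0 : 0 ≤ K) (hK : ∀ x y, f x - f y ≤ K * dist x y) (ho : ∀ x y, f x - f y ≤ o) (x y : X) :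
    markovOp q T f x - markovOp q T f y ≤ (b * K + Fintype.card ι * L * o) * dist x y := by
  have ho' : ∀ x y, |f x - f y| ≤ o := fun x y =>
    abs_le.2 ⟨by linarith [ho y x], ho x y⟩
  have h1 : ∑ i, q i x * (f (T i x) - f (T i y)) ≤ b * K * dist x y := by
    calc _ ≤ ∑ i, q i x * (b * K * dist x y) := by
          refine Finset.sum_le_sum fun i _ => mul_le_mul_of_nonneg_left ?_ (hq.nonneg i x)
          calc _ ≤ K * dist (T i x) (T i y) := hK _ _
            _ ≤ K * (b * dist x y) := mul_le_mul_of_nonneg_left (hT i x y) hK0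
            _ = _ := by ring
      _ = _ := by rw [← Finset.sum_mul, hq.sum_eq_one, one_mul]
  have h2 : ∑ i, (q i x - q i y) * (f (T i y) - f y) ≤ Fintype.card ι * L * o * dist x y := by
    calc _ ≤ ∑ _i : ι, L * dist x y * o := by
          refine Finset.sum_le_sum fun i _ => (le_abs_self _).trans ?_
          rw [abs_mul]
          exact mul_le_mul (hL i x y) (ho' _ _) (abs_nonneg _) ((abs_nonneg _).trans (hL i x y))
      _ = _ := by rw [Finset.sum_const, Finset.card_univ, nsmul_eq_mul]; ring
  have h3 : markovOp q T f x - markovOp q T f y = ∑ i, q i x * (f (T i x) - f (T i y)) +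
      ∑ i, (q i x - q i y) * (f (T i y) - f y) := by
    have : ∑ i, (q i x - q i y) * f y = 0 := by
      rw [← Finset.sum_mul, Finset.sum_sub_distrib, hq.sum_eq_one, hq.sum_eq_one]; ring
    rw [← sub_zero (_ - _), ← this]
    simp only [markovOp, ← Finset.sum_sub_distrib, ← Finset.sum_add_distrib]
    exact Finset.sum_congr rfl fun i _ => by ring
  linarith

/-- The Lipschitz constant obeys the recursion `K ↦ b * K + card ι * L * o`, and `hA` says that `A *
o` is a supersolution of it. Up to a decaying term, the Lipschitz constant is thus controlled by the
oscillation. -/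
theorem markovOp_iterate_sub_le_mul_dist (hq : IsWeight q) {b L K o A : ℝ} (hb0 : 0 ≤ b)
    (hT : ∀ i x y, dist (T i x) (T i y) ≤ b * dist x y)
    (hL : ∀ i x y, |q i x - q i y| ≤ L * dist x y) {f : X → ℝ}
    (hA0 : 0 ≤ A) (ho0 : 0 ≤ o) (hA : b * A + Fintype.card ι * L ≤ A)
    (hK0 : 0 ≤ K) (hK : ∀ x y, f x - f y ≤ K * dist x y) (ho : ∀ x y, f x - f y ≤ o) (n : ℕ) :
    ∀ x y, (markovOp q T)^[n] f x - (markovOp q T)^[n] f y ≤ (b ^ n * K + A * o) * dist x y := by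
  induction n with
  | zero =>
    intro x y
    refine (hK x y).trans (mul_le_mul_of_nonneg_right ?_ dist_nonneg)
    have := mul_nonneg hA0 ho0
    simpa using this
  | succ n ih =>
    intro x y
    rw [Function.iterate_succ_apply']
    refine (markovOp_sub_le_mul_dist hq hT hL (by positivity) ih
      (markovOp_iterate_sub_le hq ho n) x y).trans
      (mul_le_mul_of_nonneg_right ?_ dist_nonneg)
    have := mul_le_mul_of_nonneg_right hA ho0
    rw [pow_succ]
    linarith

/-- With weight `θ ^ n` the two copies share all `n` maps and end within `b ^ n * dist x y`;
otherwise only the oscillation is available. -/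
theorem markovOp_iterate_sub_le_coupling [Nonempty ι] (hq : IsWeight q) {b K o θ : ℝ}
    (hb0 : 0 ≤ b) (hT : ∀ i x y, dist (T i x) (T i y) ≤ b * dist x y) {f : X → ℝ}
    (hθ : ∀ i x, θ ≤ Fintype.card ι * q i x) (hθ0 : 0 ≤ θ)
    (hK0 : 0 ≤ K) (hK : ∀ x y, f x - f y ≤ K * dist x y) (ho : ∀ x y, f x - f y ≤ o) (n : ℕ) :
    ∀ x y, (markovOp q T)^[n] f x - (markovOp q T)^[n] f y ≤
      θ ^ n * (K * b ^ n * dist x y) + (1 - θ ^ n) * o := by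
  induction n with
  | zero => simpa using hK
  | succ n ih =>
    intro x y
    rw [Function.iterate_succ_apply']
    refine (markovOp_sub_le_of_le hq hθ (markovOp_iterate_sub_le hq ho n) x y
      (r := θ ^ n * (K * b ^ n * (b * dist x y)) + (1 - θ ^ n) * o)
      (fun i => (ih _ _).trans ?_) hθ0).trans_eq (by ring)
    gcongr
    exact hT i x y

/-- The oscillation of the iterates of a Lipschitz function tends to `0`. -/
theorem exists_markovOp_iterate_sub_le [BoundedSpace X] [Nonempty ι] (hq : IsWeight q)
    {b L η : ℝ} (hb0 : 0 ≤ b) (hb1 : b < 1)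
    (hT : ∀ i x y, dist (T i x) (T i y) ≤ b * dist x y) (hL0 : 0 ≤ L)
    (hL : ∀ i x y, |q i x - q i y| ≤ L * dist x y) (hη0 : 0 < η) (hη : ∀ i x, η ≤ q i x)
    {f : X → ℝ} {K : ℝ} (hK0 : 0 ≤ K) (hK : ∀ x y, f x - f y ≤ K * dist x y) {e : ℝ}
    (he : 0 < e) :
    ∃ n₀, ∀ n ≥ n₀, ∀ x y, (markovOp q T)^[n] f x - (markovOp q T)^[n] f y ≤ e := by
  rcases isEmpty_or_nonempty X with hX | hX
  · exact ⟨0, fun n _ x => (hX.false x).elim⟩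
  obtain ⟨D, hD0, hD⟩ : ∃ D : ℝ, 0 ≤ D ∧ ∀ x y : X, dist x y ≤ D :=
    ⟨Metric.diam (Set.univ : Set X), Metric.diam_nonneg, fun x y =>
      Metric.dist_le_diam_of_mem (Bornology.IsBounded.all _) trivial trivial⟩
  have hcard : (0 : ℝ) < Fintype.card ι := by exact_mod_cast Fintype.card_pos
  obtain ⟨θ, hθ0, hθ1, hθ⟩ : ∃ θ : ℝ, 0 < θ ∧ θ ≤ 1 ∧ ∀ i x, θ ≤ Fintype.card ι * q i x := by
    refine ⟨Fintype.card ι * η, by positivity, ?_, fun i x => by gcongr; exact hη i x⟩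
    obtain ⟨x⟩ := hX
    rw [← hq.sum_eq_one x, ← nsmul_eq_mul, ← Finset.card_univ]
    exact Finset.card_nsmul_le_sum _ _ _ fun i _ => hη i x
  set A₀ : ℝ := Fintype.card ι * L / (1 - b) with hA₀
  have h1b : 0 < 1 - b := by linarith
  have hA₀0 : 0 ≤ A₀ := by positivity
  have hA₀' : b * A₀ + Fintype.card ι * L ≤ A₀ := by
    have : A₀ * (1 - b) = Fintype.card ι * L := div_mul_cancel₀ _ h1b.ne'
    linarith
  have hlim : Tendsto (fun n : ℕ => b ^ n) atTop (𝓝 0) := tendsto_pow_atTop_nhds_zero_of_lt_one hb0 hb1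
  -- After `n` shared maps the difference is at most half the oscillation, whence the factor `γ`.
  obtain ⟨n, hn⟩ : ∃ n : ℕ, (A₀ + 1) * b ^ n * D ≤ 1 / 2 := by
    have : Tendsto (fun n : ℕ => (A₀ + 1) * b ^ n * D) atTop (𝓝 0) := by
      simpa using (hlim.const_mul (A₀ + 1)).mul_const D
    exact (this.eventually_le_const (by norm_num)).exists
  set γ : ℝ := 1 - θ ^ n / 2 with hγ
  have hθn0 : 0 < θ ^ n := by positivity
  have hθn1 : θ ^ n ≤ 1 := pow_le_one₀ hθ0.le hθ1
  have hγ0 : 0 < γ := by rw [hγ]; linarith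
  have hγ1 : γ < 1 := by rw [hγ]; linarith
  obtain ⟨j, hj⟩ : ∃ j : ℕ, b ^ j * (2 * A₀ + 1) ≤ γ := by
    have : Tendsto (fun n : ℕ => b ^ n * (2 * A₀ + 1)) atTop (𝓝 0) := by
      simpa using hlim.mul_const (2 * A₀ + 1)
    exact (this.eventually_le_const hγ0).exists
  -- A pair of bounds that reproduces itself: oscillation `o` and Lipschitz constant `(A₀ + 1) * o`.
  -- The `n` coupled steps shrink the oscillation to `γ * o`; the `j` further steps bring the
  -- Lipschitz constant down to match.
  have key : ∀ (g : X → ℝ) (o : ℝ), 0 ≤ o → (∀ x y, g x - g y ≤ o) →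
      (∀ x y, g x - g y ≤ (A₀ + 1) * o * dist x y) →
      (∀ x y, (markovOp q T)^[j + n] g x - (markovOp q T)^[j + n] g y ≤ γ * o) ∧
      (∀ x y, (markovOp q T)^[j + n] g x - (markovOp q T)^[j + n] g y ≤
        (A₀ + 1) * (γ * o) * dist x y) := by
    intro g o ho0 ho hg
    have h1 : ∀ x y, (markovOp q T)^[n] g x - (markovOp q T)^[n] g y ≤ γ * o := by
      intro x y
      refine (markovOp_iterate_sub_le_coupling hq hb0 hT hθ hθ0.le (by positivity) hg ho n
        x y).trans ?_
      have : (A₀ + 1) * o * b ^ n * dist x y ≤ 1 / 2 * o := by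
        calc _ ≤ (A₀ + 1) * o * b ^ n * D := by gcongr; exact hD x y
          _ = (A₀ + 1) * b ^ n * D * o := by ring
          _ ≤ _ := by gcongr
      have := mul_le_mul_of_nonneg_left this hθn0.le
      rw [hγ]; linarith
    have h2 : ∀ x y, (markovOp q T)^[n] g x - (markovOp q T)^[n] g y ≤
        (2 * A₀ + 1) * o * dist x y := by
      intro x y
      refine (markovOp_iterate_sub_le_mul_dist hq hb0 hT hL hA₀0 ho0 hA₀'
        (by positivity) hg ho n x y).trans (mul_le_mul_of_nonneg_right ?_ dist_nonneg)
      have : b ^ n * ((A₀ + 1) * o) ≤ 1 * ((A₀ + 1) * o) := by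
        gcongr
        exact pow_le_one₀ hb0 hb1.le
      linarith
    simp only [Function.iterate_add_apply]
    refine ⟨markovOp_iterate_sub_le hq h1 j, fun x y => ?_⟩
    refine (markovOp_iterate_sub_le_mul_dist hq hb0 hT hL hA₀0 (by positivity) hA₀'
      (by positivity) h2 h1 j x y).trans (mul_le_mul_of_nonneg_right ?_ dist_nonneg)
    have := mul_le_mul_of_nonneg_right hj ho0
    linarith
  -- The term `K * D` bounds the oscillation of `f`; the extra `K` makes `K ≤ (A₀ + 1) * o`.
  set o : ℝ := K * D + K with ho
  have ho0 : 0 ≤ o := by positivity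
  have hiter : ∀ i : ℕ,
      (∀ x y, (markovOp q T)^[(j + n) * i] f x - (markovOp q T)^[(j + n) * i] f y ≤ γ ^ i * o) ∧
      (∀ x y, (markovOp q T)^[(j + n) * i] f x - (markovOp q T)^[(j + n) * i] f y ≤
        (A₀ + 1) * (γ ^ i * o) * dist x y) := by
    intro i
    induction i with
    | zero =>
      simp only [mul_zero, Function.iterate_zero_apply, pow_zero, one_mul]
      refine ⟨fun x y => (hK x y).trans ?_, fun x y => (hK x y).trans ?_⟩
      · have := mul_le_mul_of_nonneg_left (hD x y) hK0
        linarith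
      · refine mul_le_mul_of_nonneg_right ?_ dist_nonneg
        have h1 : 0 ≤ A₀ * o := by positivity
        have h2 : 0 ≤ K * D := by positivity
        linarith
    | succ i ih =>
      rw [mul_add_one, add_comm, Function.iterate_add_apply, pow_succ', mul_assoc]
      exact key _ _ (by positivity) ih.1 ih.2
  obtain ⟨i, hi⟩ : ∃ i : ℕ, γ ^ i * o ≤ e := by
    have : Tendsto (fun i : ℕ => γ ^ i * o) atTop (𝓝 0) := by
      simpa using (tendsto_pow_atTop_nhds_zero_of_lt_one hγ0.le hγ1).mul_const o
    exact (this.eventually_le_const he).exists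
  refine ⟨(j + n) * i, fun m hm x y => ?_⟩
  obtain ⟨l, rfl⟩ := Nat.exists_eq_add_of_le' hm
  rw [Function.iterate_add_apply]
  exact markovOp_iterate_sub_le hq (fun x y => ((hiter i).1 x y).trans hi) l x y

end MarkovOp

/-! ### Existence and uniqueness of the invariant measure on a compact space. -/

section InvariantMeasure

variable {ι X : Type*} [Fintype ι] [MetricSpace X] [CompactSpace X] [MeasurableSpace X]
  [BorelSpace X] {q : ι → X → ℝ} {T : ι → X → X} {κ : Kernel X X}

theorem integrable_of_continuous {μ : Measure X} [IsFiniteMeasure μ] {f : X → ℝ}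
    (hf : Continuous f) : Integrable f μ :=
  hf.integrable_of_hasCompactSupport (HasCompactSupport.of_compactSpace f)

omit [MetricSpace X] [CompactSpace X] [BorelSpace X] in
theorem isMarkovKernel_of_eq_sum_dirac (hq : IsWeight q)
    (hκ : ∀ x, κ x = ∑ i, ENNReal.ofReal (q i x) • Measure.dirac (T i x)) :
    IsMarkovKernel κ := by
  refine ⟨fun x => ⟨?_⟩⟩
  simp only [hκ, Measure.finsetSum_apply, Measure.smul_apply, measure_univ, smul_eq_mul, mul_one]
  rw [← ENNReal.ofReal_sum_of_nonneg fun i _ => hq.nonneg i x, hq.sum_eq_one, ENNReal.ofReal_one]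

theorem integral_eq_markovOp (hq : IsWeight q)
    (hκ : ∀ x, κ x = ∑ i, ENNReal.ofReal (q i x) • Measure.dirac (T i x)) {f : X → ℝ}
    (hf : Continuous f) (x : X) : ∫ y, f y ∂(κ x) = markovOp q T f x := by
  rw [hκ, integral_finsetSum_measure fun i _ =>
    (integrable_of_continuous hf).smul_measure ENNReal.ofReal_ne_top]
  refine Finset.sum_congr rfl fun i _ => ?_
  rw [integral_smul_measure, integral_dirac, ENNReal.toReal_ofReal (hq.nonneg i x), smul_eq_mul]

theorem integral_bind_eq_integral_markovOp (hq : IsWeight q)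
    (hκ : ∀ x, κ x = ∑ i, ENNReal.ofReal (q i x) • Measure.dirac (T i x)) (μ : Measure X)
    [IsFiniteMeasure μ] {f : X → ℝ} (hf : Continuous f) :
    ∫ y, f y ∂(μ.bind κ) = ∫ x, markovOp q T f x ∂μ := by
  have := isMarkovKernel_of_eq_sum_dirac hq hκ
  rw [Measure.comp_eq_comp_const_apply, Kernel.integral_comp (integrable_of_continuous hf),
    Kernel.const_apply]
  exact integral_congr_ae (.of_forall fun x => integral_eq_markovOp hq hκ hf x)

theorem integral_markovOp_iterate_of_invariant (hq : IsWeight q)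
    (hκ : ∀ x, κ x = ∑ i, ENNReal.ofReal (q i x) • Measure.dirac (T i x))
    (hqc : ∀ i, Continuous (q i)) (hTc : ∀ i, Continuous (T i)) {μ : Measure X}
    [IsFiniteMeasure μ] (hμ : κ.Invariant μ) {f : X → ℝ} (hf : Continuous f) (n : ℕ) :
    ∫ x, (markovOp q T)^[n] f x ∂μ = ∫ x, f x ∂μ := by
  induction n with
  | zero => rfl
  | succ n ih =>
    rw [← ih, Function.iterate_succ_apply', ← integral_bind_eq_integral_markovOp hq hκ μ
      (continuous_markovOp_iterate hqc hTc hf n), hμ.def]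

theorem abs_integral_sub_integral_le {μ ν : Measure X} [IsProbabilityMeasure μ]
    [IsProbabilityMeasure ν] {g : X → ℝ} (hg : Continuous g) {e : ℝ}
    (he : ∀ x y, g x - g y ≤ e) : |∫ x, g x ∂μ - ∫ x, g x ∂ν| ≤ e := by
  have key : ∀ (μ ν : Measure X) [IsProbabilityMeasure μ] [IsProbabilityMeasure ν],
      ∫ x, g x ∂μ ≤ ∫ x, g x ∂ν + e := by
    intro μ ν _ _
    have h1 : ∀ y, ∫ x, g x ∂μ ≤ g y + e := fun y => by
      have := integral_mono (μ := μ) (integrable_of_continuous hg)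
        (integrable_const (g y + e)) fun x => by linarith [he x y]
      simpa using this
    have h2 := integral_mono (μ := ν) (integrable_const _)
      ((integrable_of_continuous hg).add (integrable_const e)) h1
    simpa [integral_add (integrable_of_continuous hg) (integrable_const e)] using h2
  rw [abs_le]
  constructor <;> linarith [key μ ν, key ν μ]

omit [CompactSpace X] in
-- Bounded Lipschitz functions characterise weak convergence, so the constant sequence `μ` converges
-- to `ν`; limits are unique.
theorem probabilityMeasure_ext_of_lipschitz {μ ν : ProbabilityMeasure X}
    (h : ∀ (f : X → ℝ) (K : NNReal), LipschitzWith K f →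
      ∫ x, f x ∂(μ : Measure X) = ∫ x, f x ∂(ν : Measure X)) :
    μ = ν := by
  have : Tendsto (fun _ : ℕ => μ) atTop (𝓝 ν) := by
    rw [tendsto_iff_forall_lipschitz_integral_tendsto]
    rintro f - ⟨K, hK⟩
    rw [h f K hK]
    exact tendsto_const_nhds
  exact tendsto_nhds_unique tendsto_const_nhds this

/-- A contractive iterated function system whose place-dependent probabilities are Lipschitz and
bounded away from zero has exactly one invariant probability measure. -/
theorem exists_forall_invariant_iff [Nonempty ι] [Nonempty X] (hq : IsWeight q)
    (hκ : ∀ x, κ x = ∑ i, ENNReal.ofReal (q i x) • Measure.dirac (T i x))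
    {b L η : ℝ} (hb0 : 0 ≤ b) (hb1 : b < 1)
    (hT : ∀ i x y, dist (T i x) (T i y) ≤ b * dist x y) (hL0 : 0 ≤ L)
    (hL : ∀ i x y, |q i x - q i y| ≤ L * dist x y) (hη0 : 0 < η) (hη : ∀ i x, η ≤ q i x) :
    ∃ μ : ProbabilityMeasure X, ∀ ν : ProbabilityMeasure X,
      κ.Invariant (ν : Measure X) ↔ ν = μ := by
  have hmark := isMarkovKernel_of_eq_sum_dirac hq hκ
  have hqc : ∀ i, Continuous (q i) := fun i =>
    (LipschitzWith.of_dist_le_mul (K := ⟨L, hL0⟩) fun x y => hL i x y).continuous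
  have hTc : ∀ i, Continuous (T i) := fun i =>
    (LipschitzWith.of_dist_le_mul (K := ⟨b, hb0⟩) fun x y => hT i x y).continuous
  have hosc : ∀ (f : X → ℝ) (K : NNReal), LipschitzWith K f → ∀ e > 0, ∃ n₀, ∀ n ≥ n₀, ∀ x y,
      (markovOp q T)^[n] f x - (markovOp q T)^[n] f y ≤ e := fun f K hf e he =>
    exists_markovOp_iterate_sub_le hq hb0 hb1 hT hL0 hL hη0 hη K.2
      (fun x y => (le_abs_self _).trans (hf.dist_le_mul x y)) he
  have huniq : ∀ μ ν : ProbabilityMeasure X, κ.Invariant (μ : Measure X) →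
      κ.Invariant (ν : Measure X) → μ = ν := by
    intro μ ν hμ hν
    refine probabilityMeasure_ext_of_lipschitz fun f K hf => ?_
    rw [← sub_eq_zero, ← abs_nonpos_iff]
    refine le_of_forall_pos_le_add fun e he => ?_
    obtain ⟨n, hn⟩ := hosc f K hf e he
    rw [← integral_markovOp_iterate_of_invariant hq hκ hqc hTc hμ hf.continuous n,
      ← integral_markovOp_iterate_of_invariant hq hκ hqc hTc hν hf.continuous n, zero_add]
    exact abs_integral_sub_integral_le (continuous_markovOp_iterate hqc hTc hf.continuous n)
      (hn n le_rfl)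
  suffices hex : ∃ μ : ProbabilityMeasure X, κ.Invariant (μ : Measure X) by
    obtain ⟨μ, hμ⟩ := hex
    exact ⟨μ, fun ν => ⟨fun hν => huniq ν μ hν hμ, fun h => h ▸ hμ⟩⟩
  obtain ⟨x₀⟩ := ‹Nonempty X›
  let step : ProbabilityMeasure X → ProbabilityMeasure X := fun μ =>
    ⟨(μ : Measure X).bind κ, inferInstance⟩
  let m₀ : ProbabilityMeasure X := ⟨Measure.dirac x₀, inferInstance⟩
  let m : ℕ → ProbabilityMeasure X := fun n => step^[n] m₀
  have hm : ∀ (n : ℕ) (f : X → ℝ), Continuous f →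
      ∫ x, f x ∂(m n : Measure X) = (markovOp q T)^[n] f x₀ := by
    intro n
    induction n with
    | zero => exact fun f hf => integral_dirac f x₀
    | succ n ih =>
      intro f hf
      have : (m (n + 1) : Measure X) = (m n : Measure X).bind κ := by
        exact congrArg (fun ν : ProbabilityMeasure X => (ν : Measure X))
          (Function.iterate_succ_apply' step n m₀)
      rw [this, integral_bind_eq_integral_markovOp hq hκ _ hf,
        ih _ (continuous_markovOp hqc hTc hf), Function.iterate_succ_apply]
  -- The space of probability measures is compact, so the laws `m n` of the chain started at `x₀`
  -- converge along an ultrafilter finer than `atTop`.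
  let U : Ultrafilter ℕ := Ultrafilter.of atTop
  have hU : (U : Filter ℕ) ≤ atTop := Ultrafilter.of_le atTop
  let μ : ProbabilityMeasure X := (U.map m).lim
  have hμ : Tendsto m U (𝓝 μ) := (U.map m).le_nhds_lim
  have hlim : ∀ f : X → ℝ, Continuous f →
      Tendsto (fun n => (markovOp q T)^[n] f x₀) U (𝓝 (∫ x, f x ∂(μ : Measure X))) := by
    intro f hf
    have := ProbabilityMeasure.tendsto_iff_forall_integral_tendsto.1 hμ
      (BoundedContinuousFunction.mkOfCompact ⟨f, hf⟩)
    simpa [hm _ f hf] using this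
  refine ⟨μ, ?_⟩
  suffices step μ = μ from congrArg (fun ν : ProbabilityMeasure X => (ν : Measure X)) this
  refine probabilityMeasure_ext_of_lipschitz fun f K hf => ?_
  have h1 : ∫ x, f x ∂(step μ : Measure X) = ∫ x, markovOp q T f x ∂(μ : Measure X) :=
    integral_bind_eq_integral_markovOp hq hκ _ hf.continuous
  have h2 := (hlim _ (continuous_markovOp hqc hTc hf.continuous)).sub (hlim f hf.continuous)
  -- No time averaging is needed: one more step replaces the `n`-th iterate by an average of its
  -- values, and its oscillation tends to `0`.
  have h3 : Tendsto (fun n => (markovOp q T)^[n] (markovOp q T f) x₀ -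
      (markovOp q T)^[n] f x₀) U (𝓝 0) := by
    refine Tendsto.mono_left (Metric.tendsto_atTop.2 fun e he => ?_) hU
    obtain ⟨n₀, hn₀⟩ := hosc f K hf (e / 2) (half_pos he)
    refine ⟨n₀, fun n hn => ?_⟩
    rw [Real.dist_eq, sub_zero, ← Function.iterate_succ_apply, Function.iterate_succ_apply']
    refine lt_of_le_of_lt ?_ (half_lt_self he)
    set g := (markovOp q T)^[n] f
    have h4 : markovOp q T g x₀ ≤ g x₀ + e / 2 :=
      (markovOp_mono hq (fun y => by linarith [hn₀ n hn y x₀]) x₀).trans_eq (markovOp_const hq _ x₀)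
    have h5 : g x₀ - e / 2 ≤ markovOp q T g x₀ :=
      (markovOp_const hq _ x₀).symm.trans_le
        (markovOp_mono hq (fun y => by linarith [hn₀ n hn x₀ y]) x₀)
    rw [abs_le]
    constructor <;> linarith
  rw [h1]
  exact sub_eq_zero.1 (tendsto_nhds_unique h2 h3)

end InvariantMeasure

/-! ### Bounds for the probabilities of play. -/

section Weights

variable {A B : Type*} [Fintype A] [DecidableEq A] [Fintype B] [DecidableEq B]

omit [DecidableEq A] [DecidableEq B] in
theorem bestReplies_nonempty [Nonempty A] (π : A → B → ℝ) (σ : B → ℝ) :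
    (bestReplies π σ).Nonempty := by
  obtain ⟨a, -, ha⟩ := Finset.exists_max_image Finset.univ (fun a => expectedPayoff π a σ)
    Finset.univ_nonempty
  exact ⟨a, by simpa [bestReplies] using ha⟩

omit [DecidableEq B] in
theorem stdSimplex_le_one (p : stdSimplex ℝ B) (b : B) : p.1 b ≤ 1 := by
  rw [← p.2.2]
  exact Finset.single_le_sum (fun b _ => p.2.1 b) (Finset.mem_univ b)

omit [DecidableEq B] in
theorem abs_sub_le_dist (p p' : stdSimplex ℝ B) (b : B) : |p.1 b - p'.1 b| ≤ dist p p' :=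
  dist_le_pi_dist p.1 p'.1 b

omit [DecidableEq B] in
theorem replyWeight_nonneg (π : A → B → ℝ) (σ : B → ℝ) (a : A) :
    0 ≤ if a ∈ bestReplies π σ then 1 / ((bestReplies π σ).card : ℝ) else 0 := by
  split_ifs <;> positivity

omit [DecidableEq B] in
theorem replyWeight_le_one (π : A → B → ℝ) (σ : B → ℝ) (a : A) :
    (if a ∈ bestReplies π σ then 1 / ((bestReplies π σ).card : ℝ) else 0) ≤ 1 := by
  split_ifs with h
  · rw [div_le_one (by exact_mod_cast Finset.card_pos.2 ⟨a, h⟩)]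
    exact_mod_cast Finset.card_pos.2 ⟨a, h⟩
  · exact zero_le_one

theorem bestReplyProb_nonneg (π : A → B → ℝ) (k : ℕ) (p : stdSimplex ℝ B) (a : A) :
    0 ≤ bestReplyProb π k p a :=
  Finset.sum_nonneg fun _ _ =>
    mul_nonneg (Finset.prod_nonneg fun _ _ => p.2.1 _) (replyWeight_nonneg _ _ _)

omit [DecidableEq B] in
theorem sum_prod_sample (k : ℕ) (p : stdSimplex ℝ B) : ∑ ω : Fin k → B, ∏ j, p.1 (ω j) = 1 := by
  have := Finset.prod_univ_sum (fun _ : Fin k => (Finset.univ : Finset B)) fun _ b => p.1 b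
  rw [Fintype.piFinset_univ] at this
  rw [← this, p.2.2, Finset.prod_const_one]

theorem sum_bestReplyProb [Nonempty A] (π : A → B → ℝ) (k : ℕ) (p : stdSimplex ℝ B) :
    ∑ a, bestReplyProb π k p a = 1 := by
  unfold bestReplyProb
  rw [Finset.sum_comm]
  refine (Finset.sum_congr rfl fun ω _ => ?_).trans (sum_prod_sample k p)
  rw [← Finset.mul_sum, Finset.sum_ite_mem, Finset.univ_inter, Finset.sum_const, nsmul_eq_mul,
    mul_one_div_cancel, mul_one]
  exact_mod_cast (Finset.card_pos.2 (bestReplies_nonempty π (empirical ω))).ne'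

theorem sum_playProb [Nonempty A] (π : A → B → ℝ) (k : ℕ) (ε : ℝ) (p : stdSimplex ℝ B) :
    ∑ a, playProb π k ε p a = 1 := by
  unfold playProb
  rw [Finset.sum_add_distrib, ← Finset.mul_sum, sum_bestReplyProb, Finset.sum_const,
    Finset.card_univ, nsmul_eq_mul, mul_div_cancel₀]
  · ring
  · exact_mod_cast Fintype.card_ne_zero

theorem div_card_le_playProb (π : A → B → ℝ) (k : ℕ) {ε : ℝ} (hε : ε ≤ 1)
    (p : stdSimplex ℝ B) (a : A) : ε / Fintype.card A ≤ playProb π k ε p a :=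
  le_add_of_nonneg_left (mul_nonneg (sub_nonneg.2 hε) (bestReplyProb_nonneg π k p a))

theorem playProb_nonneg (π : A → B → ℝ) (k : ℕ) {ε : ℝ} (hε : ε ∈ Set.Icc (0 : ℝ) 1)
    (p : stdSimplex ℝ B) (a : A) : 0 ≤ playProb π k ε p a :=
  (div_nonneg hε.1 (Nat.cast_nonneg _)).trans (div_card_le_playProb π k hε.2 p a)

theorem playProb_le_one [Nonempty A] (π : A → B → ℝ) (k : ℕ) {ε : ℝ}
    (hε : ε ∈ Set.Icc (0 : ℝ) 1) (p : stdSimplex ℝ B) (a : A) : playProb π k ε p a ≤ 1 := by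
  rw [← sum_playProb π k ε p]
  exact Finset.single_le_sum (fun a _ => playProb_nonneg π k hε p a) (Finset.mem_univ a)

theorem playProb_zero (π : A → B → ℝ) (k : ℕ) (p : stdSimplex ℝ B) (a : A) :
    playProb π k 0 p a = bestReplyProb π k p a := by
  simp [playProb]

theorem abs_prod_sub_prod_le {ι : Type*} (s : Finset ι) {x y : ι → ℝ}
    (hx : ∀ i, x i ∈ Set.Icc (0 : ℝ) 1) (hy : ∀ i, y i ∈ Set.Icc (0 : ℝ) 1) :
    |∏ i ∈ s, x i - ∏ i ∈ s, y i| ≤ ∑ i ∈ s, |x i - y i| := by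
  classical
  induction s using Finset.induction_on with
  | empty => simp
  | insert i s hi ih =>
    rw [Finset.prod_insert hi, Finset.prod_insert hi, Finset.sum_insert hi]
    have h1 : x i * ∏ j ∈ s, x j - y i * ∏ j ∈ s, y j =
        (x i - y i) * ∏ j ∈ s, x j + y i * (∏ j ∈ s, x j - ∏ j ∈ s, y j) := by ring
    have h2 : |∏ j ∈ s, x j| ≤ 1 := by
      rw [abs_of_nonneg (Finset.prod_nonneg fun j _ => (hx j).1)]
      exact Finset.prod_le_one (fun j _ => (hx j).1) fun j _ => (hx j).2
    have h3 : |y i| ≤ 1 := abs_le.2 ⟨by linarith [(hy i).1], (hy i).2⟩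
    rw [h1]
    refine (abs_add_le _ _).trans (add_le_add ?_ ?_)
    · rw [abs_mul]
      exact mul_le_of_le_one_right (abs_nonneg _) h2
    · rw [abs_mul]
      exact (mul_le_of_le_one_left (abs_nonneg _) h3).trans ih

theorem abs_bestReplyProb_sub_le (π : A → B → ℝ) (k : ℕ) (p p' : stdSimplex ℝ B) (a : A) :
    |bestReplyProb π k p a - bestReplyProb π k p' a| ≤
      Fintype.card (Fin k → B) * k * dist p p' := by
  unfold bestReplyProb
  rw [← Finset.sum_sub_distrib]
  refine (Finset.abs_sum_le_sum_abs _ _).trans ?_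
  have : ∀ ω ∈ (Finset.univ : Finset (Fin k → B)), |(∏ j, p.1 (ω j)) *
      (if a ∈ bestReplies π (empirical ω)
        then 1 / ((bestReplies π (empirical ω)).card : ℝ) else 0) - (∏ j, p'.1 (ω j)) *
      (if a ∈ bestReplies π (empirical ω)
        then 1 / ((bestReplies π (empirical ω)).card : ℝ) else 0)| ≤ k * dist p p' := by
    intro ω _
    rw [← sub_mul, abs_mul, abs_of_nonneg (replyWeight_nonneg _ _ _)]
    refine (mul_le_of_le_one_right (abs_nonneg _) (replyWeight_le_one _ _ _)).trans ?_
    refine (abs_prod_sub_prod_le _ (fun j => ⟨p.2.1 _, stdSimplex_le_one p _⟩)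
      fun j => ⟨p'.2.1 _, stdSimplex_le_one p' _⟩).trans ?_
    refine (Finset.sum_le_card_nsmul _ _ _ fun j _ => abs_sub_le_dist p p' (ω j)).trans_eq ?_
    simp
  refine (Finset.sum_le_card_nsmul _ _ _ this).trans_eq ?_
  rw [Finset.card_univ, nsmul_eq_mul, mul_assoc]

theorem abs_playProb_sub_le (π : A → B → ℝ) (k : ℕ) {ε : ℝ} (hε : ε ∈ Set.Icc (0 : ℝ) 1)
    (p p' : stdSimplex ℝ B) (a : A) :
    |playProb π k ε p a - playProb π k ε p' a| ≤ Fintype.card (Fin k → B) * k * dist p p' := by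
  have : playProb π k ε p a - playProb π k ε p' a =
      (1 - ε) * (bestReplyProb π k p a - bestReplyProb π k p' a) := by unfold playProb; ring
  rw [this, abs_mul, abs_of_nonneg (sub_nonneg.2 hε.2)]
  exact (mul_le_of_le_one_left (abs_nonneg _) (by linarith [hε.1])).trans
    (abs_bestReplyProb_sub_le π k p p' a)

theorem abs_playProb_sub_playProb_zero_le [Nonempty A] (π : A → B → ℝ) (k : ℕ) {ε : ℝ}
    (hε : 0 ≤ ε) (p : stdSimplex ℝ B) (a : A) :
    |playProb π k ε p a - playProb π k 0 p a| ≤ ε := by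
  have : playProb π k ε p a - playProb π k 0 p a =
      ε * (1 / (Fintype.card A : ℝ) - bestReplyProb π k p a) := by unfold playProb; ring
  rw [this, abs_mul, abs_of_nonneg hε]
  refine mul_le_of_le_one_right hε (abs_le.2 ⟨?_, ?_⟩)
  · have h1 := playProb_le_one π k ⟨le_rfl, zero_le_one⟩ p a
    rw [playProb_zero] at h1
    have : (0 : ℝ) ≤ 1 / Fintype.card A := by positivity
    linarith
  · have h1 := bestReplyProb_nonneg π k p a
    have : (1 : ℝ) / Fintype.card A ≤ 1 := by
      rw [div_le_one (by exact_mod_cast Fintype.card_pos)]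
      exact_mod_cast Fintype.card_pos
    linarith

theorem dist_update_le (β : unitInterval) (s : A) (p p' : stdSimplex ℝ A) :
    dist (update β p s) (update β p' s) ≤ β * dist p p' := by
  rw [Subtype.dist_eq, dist_pi_le_iff (mul_nonneg β.2.1 dist_nonneg)]
  intro a
  have : (update β p s).1 a - (update β p' s).1 a = β * (p.1 a - p'.1 a) := by
    simp only [update]; ring
  rw [Real.dist_eq, this, abs_mul, abs_of_nonneg β.2.1]
  exact mul_le_mul_of_nonneg_left (abs_sub_le_dist p p' a) β.2.1

end Weights

/-! ### The sampler as an iterated function system, and its dependence on the error probability. -/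

section Joint

variable {S₁ S₂ : Type*} [Fintype S₁] [DecidableEq S₁] [Fintype S₂] [DecidableEq S₂]

/-- The probability that the pure profile `s` is played in the state `p`. -/
noncomputable def jointProb (u₁ : S₁ → S₂ → ℝ) (u₂ : S₂ → S₁ → ℝ) (k : ℕ) (ε : ℝ)
    (s : S₁ × S₂) (p : State S₁ S₂) : ℝ :=
  playProb u₁ k ε p.2 s.1 * playProb u₂ k ε p.1 s.2

/-- The state that follows `p` when the pure profile `s` is played. -/
noncomputable def jointUpdate (β : unitInterval) (s : S₁ × S₂) (p : State S₁ S₂) :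
    State S₁ S₂ :=
  (update β p.1 s.1, update β p.2 s.2)

variable (u₁ : S₁ → S₂ → ℝ) (u₂ : S₂ → S₁ → ℝ) (k : ℕ) (β : unitInterval)

theorem kernel_apply_eq_sum (ε : ℝ) (p : State S₁ S₂) :
    kernel u₁ u₂ k β ε p = ∑ s, ENNReal.ofReal (jointProb u₁ u₂ k ε s p) •
      Measure.dirac (jointUpdate β s p) := by
  rw [Fintype.sum_prod_type]
  rfl

theorem isWeight_jointProb [Nonempty S₁] [Nonempty S₂] {ε : ℝ} (hε : ε ∈ Set.Icc (0 : ℝ) 1) :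
    IsWeight (jointProb u₁ u₂ k ε) where
  nonneg s p := mul_nonneg (playProb_nonneg u₁ k hε _ _) (playProb_nonneg u₂ k hε _ _)
  sum_eq_one p := by
    rw [Fintype.sum_prod_type]
    simp only [jointProb, ← Finset.mul_sum, sum_playProb, mul_one]

theorem dist_jointUpdate_le (s : S₁ × S₂) (p p' : State S₁ S₂) :
    dist (jointUpdate β s p) (jointUpdate β s p') ≤ β * dist p p' :=
  max_le
    ((dist_update_le β s.1 p.1 p'.1).trans
      (mul_le_mul_of_nonneg_left (le_max_left _ _) β.2.1))
    ((dist_update_le β s.2 p.2 p'.2).trans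
      (mul_le_mul_of_nonneg_left (le_max_right _ _) β.2.1))

theorem abs_mul_sub_mul_le {a b a' b' r r' : ℝ} (ha : a ∈ Set.Icc (0 : ℝ) 1)
    (hb' : b' ∈ Set.Icc (0 : ℝ) 1) (h : |a - a'| ≤ r) (h' : |b - b'| ≤ r') :
    |a * b - a' * b'| ≤ r + r' := by
  have h1 : a * b - a' * b' = (a - a') * b' + a * (b - b') := by ring
  rw [h1]
  refine (abs_add_le _ _).trans (add_le_add ?_ ?_)
  · rw [abs_mul, abs_of_nonneg hb'.1]
    exact (mul_le_of_le_one_right (abs_nonneg _) hb'.2).trans h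
  · rw [abs_mul, abs_of_nonneg ha.1]
    exact (mul_le_of_le_one_left (abs_nonneg _) ha.2).trans h'

theorem abs_jointProb_sub_le [Nonempty S₁] [Nonempty S₂] {ε : ℝ} (hε : ε ∈ Set.Icc (0 : ℝ) 1)
    (s : S₁ × S₂) (p p' : State S₁ S₂) :
    |jointProb u₁ u₂ k ε s p - jointProb u₁ u₂ k ε s p'| ≤
      (Fintype.card (Fin k → S₂) * k + Fintype.card (Fin k → S₁) * k) * dist p p' := by
  rw [add_mul]
  refine abs_mul_sub_mul_le ⟨playProb_nonneg _ _ hε _ _, playProb_le_one _ _ hε _ _⟩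
    ⟨playProb_nonneg _ _ hε _ _, playProb_le_one _ _ hε _ _⟩
    ((abs_playProb_sub_le u₁ k hε _ _ _).trans ?_) ((abs_playProb_sub_le u₂ k hε _ _ _).trans ?_)
  · exact mul_le_mul_of_nonneg_left (le_max_right _ _) (by positivity)
  · exact mul_le_mul_of_nonneg_left (le_max_left _ _) (by positivity)

theorem abs_jointProb_sub_jointProb_zero_le [Nonempty S₁] [Nonempty S₂] {ε : ℝ}
    (hε : ε ∈ Set.Icc (0 : ℝ) 1) (s : S₁ × S₂) (p : State S₁ S₂) :
    |jointProb u₁ u₂ k ε s p - jointProb u₁ u₂ k 0 s p| ≤ ε + ε :=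
  abs_mul_sub_mul_le ⟨playProb_nonneg _ _ hε _ _, playProb_le_one _ _ hε _ _⟩
    ⟨playProb_nonneg _ _ ⟨le_rfl, zero_le_one⟩ _ _, playProb_le_one _ _ ⟨le_rfl, zero_le_one⟩ _ _⟩
    (abs_playProb_sub_playProb_zero_le u₁ k hε.1 _ _)
    (abs_playProb_sub_playProb_zero_le u₂ k hε.1 _ _)

theorem continuous_jointProb [Nonempty S₁] [Nonempty S₂] {ε : ℝ} (hε : ε ∈ Set.Icc (0 : ℝ) 1)
    (s : S₁ × S₂) : Continuous (jointProb u₁ u₂ k ε s) :=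
  (LipschitzWith.of_dist_le_mul
    (K := Fintype.card (Fin k → S₂) * k + Fintype.card (Fin k → S₁) * k) fun p p' => by
      simpa [Real.dist_eq] using abs_jointProb_sub_le u₁ u₂ k hε s p p').continuous

theorem continuous_jointUpdate (s : S₁ × S₂) :
    Continuous (jointUpdate β s : State S₁ S₂ → State S₁ S₂) :=
  (LipschitzWith.of_dist_le_mul (K := ⟨β, β.2.1⟩)
    fun p p' => dist_jointUpdate_le β s p p').continuous

/-- The Markov operator of the recency weighted sampler. -/
noncomputable def samplerOp (ε : ℝ) : (State S₁ S₂ → ℝ) → State S₁ S₂ → ℝ :=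
  markovOp (jointProb u₁ u₂ k ε) (jointUpdate β)

theorem exists_forall_kernel_invariant_iff [Nonempty S₁] [Nonempty S₂] (hβ : (β : ℝ) < 1)
    {ε : ℝ} (hε : ε ∈ Set.Ioc (0 : ℝ) 1) :
    ∃ μ : ProbabilityMeasure (State S₁ S₂), ∀ ν : ProbabilityMeasure (State S₁ S₂),
      (kernel u₁ u₂ k β ε).Invariant (ν : Measure (State S₁ S₂)) ↔ ν = μ := by
  have hε' : ε ∈ Set.Icc (0 : ℝ) 1 := Set.Ioc_subset_Icc_self hε
  have h1 : (0 : ℝ) < Fintype.card S₁ := by exact_mod_cast Fintype.card_pos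
  have h2 : (0 : ℝ) < Fintype.card S₂ := by exact_mod_cast Fintype.card_pos
  refine exists_forall_invariant_iff (isWeight_jointProb u₁ u₂ k hε')
    (kernel_apply_eq_sum u₁ u₂ k β ε) β.2.1 hβ (dist_jointUpdate_le β) (by positivity)
    -- The lower bound `η` comes from both players erring: each profile then has probability at
    -- least the product of the two uniform error weights.
    (abs_jointProb_sub_le u₁ u₂ k hε') (η := ε / Fintype.card S₁ * (ε / Fintype.card S₂))
    (mul_pos (div_pos hε.1 h1) (div_pos hε.1 h2)) fun s p => ?_
  exact mul_le_mul (div_card_le_playProb u₁ k hε.2 _ _) (div_card_le_playProb u₂ k hε.2 _ _)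
    (div_nonneg hε.1.le h2.le) (playProb_nonneg u₁ k hε' _ _)

/-- One step at a time, the perturbed operator is exchanged for the unperturbed one. Each exchange
acts on a function with values in `[0, 1]` and changes each of the profile probabilities by at most
`ε + ε`. -/
theorem samplerOp_iterate_le_add [Nonempty S₁] [Nonempty S₂] {ε : ℝ}
    (hε : ε ∈ Set.Icc (0 : ℝ) 1) {f : State S₁ S₂ → ℝ} (hf0 : ∀ p, 0 ≤ f p) (hf1 : ∀ p, f p ≤ 1)
    (n : ℕ) : ∀ p, (samplerOp u₁ u₂ k β ε)^[n] f p ≤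
      (samplerOp u₁ u₂ k β 0)^[n] f p + n * (Fintype.card (S₁ × S₂) * (ε + ε)) := by
  have h0 : IsWeight (jointProb u₁ u₂ k 0) := isWeight_jointProb u₁ u₂ k ⟨le_rfl, zero_le_one⟩
  have hstep : ∀ g : State S₁ S₂ → ℝ, (∀ p, 0 ≤ g p) → (∀ p, g p ≤ 1) → ∀ p,
      samplerOp u₁ u₂ k β ε g p ≤
        samplerOp u₁ u₂ k β 0 g p + Fintype.card (S₁ × S₂) * (ε + ε) := by
    intro g hg0 hg1 p
    rw [← sub_le_iff_le_add']
    simp only [samplerOp, markovOp, ← Finset.sum_sub_distrib, ← sub_mul]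
    refine (Finset.sum_le_card_nsmul _ _ (ε + ε) fun s _ => ?_).trans_eq (by
      rw [Finset.card_univ, nsmul_eq_mul])
    refine (le_abs_self _).trans ?_
    rw [abs_mul, abs_of_nonneg (hg0 _)]
    exact (mul_le_of_le_one_right (abs_nonneg _) (hg1 _)).trans
      (abs_jointProb_sub_jointProb_zero_le u₁ u₂ k hε s p)
  have hg : ∀ n p, 0 ≤ (samplerOp u₁ u₂ k β 0)^[n] f p ∧
      (samplerOp u₁ u₂ k β 0)^[n] f p ≤ 1 := by
    intro n
    induction n with
    | zero => exact fun p => ⟨hf0 p, hf1 p⟩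
    | succ n ih =>
      intro p
      rw [Function.iterate_succ_apply']
      exact ⟨(markovOp_const h0 0 p).symm.trans_le (markovOp_mono h0 (fun p => (ih p).1) p),
        (markovOp_mono h0 (fun p => (ih p).2) p).trans_eq (markovOp_const h0 1 p)⟩
  induction n with
  | zero => simp
  | succ n ih =>
    intro p
    rw [Function.iterate_succ_apply', Function.iterate_succ_apply']
    have hq := isWeight_jointProb u₁ u₂ k hε
    have h1 := (markovOp_mono (T := jointUpdate β) hq ih p).trans_eq
      (markovOp_add_const hq ((samplerOp u₁ u₂ k β 0)^[n] f) _ p)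
    have h2 := hstep _ (fun p => (hg n p).1) (fun p => (hg n p).2) p
    refine h1.trans ((add_le_add_left h2 _).trans_eq ?_)
    push_cast
    ring

end Joint

/-! ### Samples, lattice strategies and the weights of actions after an update. -/

section Samples

variable {A B : Type*} [Fintype A] [DecidableEq A] [Fintype B] [DecidableEq B]

omit [Fintype B] in
theorem empirical_apply {k : ℕ} (ω : Fin k → B) (b : B) :
    empirical ω b = ((Finset.univ.filter fun j => ω j = b).card : ℝ) / k := by
  simp only [empirical, unitVec, Finset.sum_boole, eq_comm (a := b)]
  ring

theorem empirical_mem_lattice {k : ℕ} {C : Finset B} {ω : Fin k → B} (hω : ∀ j, ω j ∈ C) :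
    empirical ω ∈ lattice k C := by
  refine ⟨⟨fun b => (Finset.univ.filter fun j => ω j = b).card, ?_, empirical_apply ω⟩,
    fun b hb => ?_⟩
  · rw [← Finset.card_eq_sum_card_fiberwise (fun j _ => Finset.mem_coe.2 (Finset.mem_univ (ω j)))]
    simp
  · have : (Finset.univ.filter fun j => ω j = b) = ∅ :=
      Finset.filter_eq_empty_iff.2 fun j _ hj => hb (hj ▸ hω j)
    rw [empirical_apply, this]
    simp

theorem exists_empirical_eq {k : ℕ} (hk : 1 ≤ k) {C : Finset B} {σ : B → ℝ}
    (hσ : σ ∈ lattice k C) : ∃ ω : Fin k → B, (∀ j, ω j ∈ C) ∧ empirical ω = σ := by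
  obtain ⟨⟨n, hn, hσn⟩, hC⟩ := hσ
  have hk0 : (k : ℝ) ≠ 0 := by exact_mod_cast (by omega : k ≠ 0)
  -- The sample lists each action `b` exactly `n b` times.
  have e : Fin k ≃ Σ b, Fin (n b) := Fintype.equivOfCardEq (by simp [hn])
  refine ⟨fun j => (e j).1, fun j => ?_, ?_⟩
  · by_contra hj
    have h0 : n (e j).1 = 0 := by
      have := hC _ hj
      rw [hσn, div_eq_zero_iff, or_iff_left hk0] at this
      exact_mod_cast this
    exact (Fin.cast h0 (e j).2).elim0
  · funext b
    rw [empirical_apply, hσn]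
    congr 2
    have h1 : (Finset.univ.filter fun j => (e j).1 = b).card =
        Fintype.card {x : Σ b, Fin (n b) // x.1 = b} := by
      rw [Fintype.card_subtype]
      refine Finset.card_equiv e fun j => by simp
    rw [h1, Fintype.card_congr (Equiv.sigmaSubtype b), Fintype.card_fin]

theorem pow_div_card_le_bestReplyProb (π : A → B → ℝ) {k : ℕ} (p : stdSimplex ℝ B) {c : ℝ}
    (hc : 0 ≤ c) {ω : Fin k → B} (hω : ∀ j, c ≤ p.1 (ω j)) {a : A}
    (ha : a ∈ bestReplies π (empirical ω)) :
    c ^ k / Fintype.card A ≤ bestReplyProb π k p a := by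
  refine le_trans ?_ (Finset.single_le_sum (fun ω _ => mul_nonneg
    (Finset.prod_nonneg fun _ _ => p.2.1 _) (replyWeight_nonneg _ _ _)) (Finset.mem_univ ω))
  rw [if_pos ha, div_eq_mul_one_div]
  have h1 : c ^ k ≤ ∏ j, p.1 (ω j) := by
    simpa using Finset.prod_le_prod (s := (Finset.univ : Finset (Fin k))) (f := fun _ => c)
      (fun _ _ => hc) fun j _ => hω j
  have h2 : 0 < (bestReplies π (empirical ω)).card := Finset.card_pos.2 ⟨a, ha⟩
  have h3 : (bestReplies π (empirical ω)).card ≤ Fintype.card A := Finset.card_le_univ _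
  refine mul_le_mul h1 (one_div_le_one_div_of_le (by exact_mod_cast h2) (by exact_mod_cast h3))
    (by positivity) (Finset.prod_nonneg fun _ _ => p.2.1 _)

theorem exists_pow_div_card_le_bestReplyProb [Nonempty A] (π : A → B → ℝ) (k : ℕ)
    (p : stdSimplex ℝ B) {c : ℝ} (hc : 0 ≤ c) {b : B} (hb : c ≤ p.1 b) {C : Finset B}
    (hbC : b ∈ C) : ∃ σ ∈ lattice k C, ∃ a ∈ bestReplies π σ,
      c ^ k / Fintype.card A ≤ bestReplyProb π k p a := by
  obtain ⟨a, ha⟩ := bestReplies_nonempty π (empirical fun _ : Fin k => b)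
  exact ⟨_, empirical_mem_lattice fun _ => hbC, a, ha,
    pow_div_card_le_bestReplyProb π p hc (fun _ => hb) ha⟩

/-- The left side is the probability that all `k` draws fall in `C'`, and every best reply to such a
sample lies in `C`. -/
theorem pow_le_sum_bestReplyProb [Nonempty A] (π : A → B → ℝ) (k : ℕ) (p : stdSimplex ℝ B)
    {C : Finset A} {C' : Finset B} (hC : ∀ σ ∈ lattice k C', bestReplies π σ ⊆ C) :
    (∑ b ∈ C', p.1 b) ^ k ≤ ∑ a ∈ C, bestReplyProb π k p a := by
  have h1 : (∑ b ∈ C', p.1 b) ^ k =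
      ∑ ω ∈ Fintype.piFinset fun _ : Fin k => C', ∏ j, p.1 (ω j) := by
    rw [← Finset.prod_univ_sum]
    simp
  unfold bestReplyProb
  rw [h1, Finset.sum_comm]
  simp only [← Finset.mul_sum]
  refine (Finset.sum_le_sum fun ω hω => ?_).trans
    (Finset.sum_le_univ_sum_of_nonneg fun ω => mul_nonneg
      (Finset.prod_nonneg fun _ _ => p.2.1 _) (Finset.sum_nonneg fun a _ => replyWeight_nonneg _ _ _))
  have hsub := hC _ (empirical_mem_lattice (Fintype.mem_piFinset.1 hω))
  rw [Finset.sum_ite_mem, Finset.inter_eq_right.2 hsub, Finset.sum_const, nsmul_eq_mul,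
    mul_one_div_cancel, mul_one]
  exact_mod_cast (Finset.card_pos.2 (bestReplies_nonempty π (empirical ω))).ne'

omit [DecidableEq B] in
theorem one_sub_sum_nonneg (p : stdSimplex ℝ B) (C : Finset B) : 0 ≤ 1 - ∑ b ∈ C, p.1 b := by
  rw [← p.2.2, sub_nonneg]
  exact Finset.sum_le_univ_sum_of_nonneg p.2.1

theorem one_sub_mul_le_sum_bestReplyProb [Nonempty A] (π : A → B → ℝ) (k : ℕ)
    (p : stdSimplex ℝ B) {C : Finset A} {C' : Finset B}
    (hC : ∀ σ ∈ lattice k C', bestReplies π σ ⊆ C) :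
    1 - k * (1 - ∑ b ∈ C', p.1 b) ≤ ∑ a ∈ C, bestReplyProb π k p a := by
  refine le_trans ?_ (pow_le_sum_bestReplyProb π k p hC)
  have h0 : 0 ≤ ∑ b ∈ C', p.1 b := Finset.sum_nonneg fun b _ => p.2.1 b
  have := one_add_mul_le_pow (a := ∑ b ∈ C', p.1 b - 1) (by linarith) k
  rw [add_sub_cancel] at this
  linarith

theorem update_apply_ge (β : unitInterval) (p : stdSimplex ℝ A) (s a : A) :
    β * p.1 a ≤ (update β p s).1 a := by
  have : (0 : ℝ) ≤ unitVec s a := by unfold unitVec; split_ifs <;> norm_num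
  exact le_add_of_nonneg_right (mul_nonneg (sub_nonneg.2 β.2.2) this)

theorem update_apply_self_ge (β : unitInterval) (p : stdSimplex ℝ A) (s : A) :
    1 - β ≤ (update β p s).1 s := by
  have : (update β p s).1 s = β * p.1 s + (1 - β) := by simp [update, unitVec]
  rw [this]
  exact le_add_of_nonneg_left (mul_nonneg β.2.1 (p.2.1 s))

theorem min_le_update_of_mem_insert (β : unitInterval) {p : stdSimplex ℝ A} {E : Finset A} {c : ℝ}
    (h : ∀ a ∈ E, c ≤ p.1 a) (s : A) {a : A} (ha : a ∈ insert s E) :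
    min (β * c) (1 - β) ≤ (update β p s).1 a := by
  rcases Finset.mem_insert.1 ha with rfl | ha
  · exact (min_le_right _ _).trans (update_apply_self_ge β p a)
  · exact (min_le_left _ _).trans ((mul_le_mul_of_nonneg_left (h a ha) β.2.1).trans
      (update_apply_ge β p s a))

theorem one_sub_sum_update (β : unitInterval) (p : stdSimplex ℝ A) {s : A} {C : Finset A}
    (hs : s ∈ C) : 1 - ∑ a ∈ C, (update β p s).1 a = β * (1 - ∑ a ∈ C, p.1 a) := by
  have : ∑ a ∈ C, (update β p s).1 a = β * ∑ a ∈ C, p.1 a + (1 - β) := by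
    simp only [update, Finset.sum_add_distrib, ← Finset.mul_sum]
    simp [unitVec, hs]
  rw [this]
  ring

omit [DecidableEq A] in
theorem exists_div_card_le {p : A → ℝ} {C : Finset A} (hC : C.Nonempty) {c : ℝ} (hc : 0 ≤ c)
    (h : c ≤ ∑ a ∈ C, p a) : ∃ a ∈ C, c / Fintype.card A ≤ p a := by
  refine Finset.exists_le_of_sum_le hC (le_trans ?_ h)
  have h1 : (0 : ℝ) < Fintype.card A := by
    exact_mod_cast Fintype.card_pos_iff.2 ⟨hC.choose⟩
  rw [Finset.sum_const, nsmul_eq_mul, mul_div_assoc', div_le_iff₀ h1, mul_comm]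
  exact mul_le_mul_of_nonneg_left (by exact_mod_cast Finset.card_le_univ C) hc

end Samples

section MarkovPath

variable {ι X : Type*} [Fintype ι] {q : ι → X → ℝ} {T : ι → X → X}

/-- In `1 - markovOp q T f x` all terms are nonnegative, so the `i`-th may be kept alone. Applied
repeatedly, this turns a single path of positive probability into a bound on iterates. -/
theorem markovOp_le_one_sub (hq : IsWeight q) {f : X → ℝ} (hf : ∀ x, f x ≤ 1) {x : X} {i : ι}
    {c η : ℝ} (hc0 : 0 ≤ c) (hc : c ≤ q i x) (hη : f (T i x) ≤ 1 - η) :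
    markovOp q T f x ≤ 1 - c * η := by
  have h1 : 1 - markovOp q T f x = ∑ j, q j x * (1 - f (T j x)) := by
    simp only [markovOp, mul_sub, mul_one, Finset.sum_sub_distrib, hq.sum_eq_one]
  have h2 : q i x * (1 - f (T i x)) ≤ ∑ j, q j x * (1 - f (T j x)) :=
    Finset.single_le_sum (f := fun j => q j x * (1 - f (T j x)))
      (fun j _ => mul_nonneg (hq.nonneg j x) (sub_nonneg.2 (hf _))) (Finset.mem_univ i)
  have h3 : c * (1 - f (T i x)) ≤ q i x * (1 - f (T i x)) :=
    mul_le_mul_of_nonneg_right hc (sub_nonneg.2 (hf _))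
  have h4 : c * η ≤ c * (1 - f (T i x)) := mul_le_mul_of_nonneg_left (by linarith) hc0
  linarith

end MarkovPath

/-! ### The potential of the minimal CURB blocks. -/

section Lyapunov

variable {S₁ S₂ : Type*} [Fintype S₁] [DecidableEq S₁] [Fintype S₂] [DecidableEq S₂]

/-- The total weight that the two components of `p` put outside the block `C`. -/
def outsideMass (C : Finset S₁ × Finset S₂) (p : State S₁ S₂) : ℝ :=
  (1 - ∑ s ∈ C.1, p.1.1 s) + (1 - ∑ s ∈ C.2, p.2.1 s)

omit [DecidableEq S₁] [DecidableEq S₂] in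
theorem outsideMass_nonneg (C : Finset S₁ × Finset S₂) (p : State S₁ S₂) :
    0 ≤ outsideMass C p :=
  add_nonneg (one_sub_sum_nonneg p.1 C.1) (one_sub_sum_nonneg p.2 C.2)

omit [DecidableEq S₁] [DecidableEq S₂] in
theorem outsideMass_le_two (C : Finset S₁ × Finset S₂) (p : State S₁ S₂) :
    outsideMass C p ≤ 2 := by
  have h1 : 0 ≤ ∑ s ∈ C.1, p.1.1 s := Finset.sum_nonneg fun s _ => p.1.2.1 s
  have h2 : 0 ≤ ∑ s ∈ C.2, p.2.1 s := Finset.sum_nonneg fun s _ => p.2.2.1 s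
  unfold outsideMass
  linarith

omit [DecidableEq S₁] [DecidableEq S₂] in
theorem continuous_outsideMass (C : Finset S₁ × Finset S₂) :
    Continuous (outsideMass C : State S₁ S₂ → ℝ) := by
  unfold outsideMass
  fun_prop

theorem outsideMass_jointUpdate (β : unitInterval) {C : Finset S₁ × Finset S₂} {s : S₁ × S₂}
    (hs₁ : s.1 ∈ C.1) (hs₂ : s.2 ∈ C.2) (p : State S₁ S₂) :
    outsideMass C (jointUpdate β s p) = β * outsideMass C p := by
  simp only [outsideMass, jointUpdate, one_sub_sum_update β _ hs₁, one_sub_sum_update β _ hs₂]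
  ring

variable (u₁ : S₁ → S₂ → ℝ) (u₂ : S₂ → S₁ → ℝ) (k : ℕ) (β : unitInterval)

/-- The capped and scaled weight outside of the nearest minimal CURB block. -/
noncomputable def potential (M : ℝ) (p : State S₁ S₂) : ℝ :=
  ⨅ C : {C : Finset S₁ × Finset S₂ // IsMinCurb u₁ u₂ k C}, min 1 (M * outsideMass C.1 p)

omit [DecidableEq S₁] [DecidableEq S₂] in
theorem exists_isMinCurb_le {E : Finset S₁ × Finset S₂} (hE : IsCurb u₁ u₂ k E) :
    ∃ C ≤ E, IsMinCurb u₁ u₂ k C :=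
  (Set.toFinite {C | IsCurb u₁ u₂ k C}).exists_le_minimal hE

omit [DecidableEq S₁] [DecidableEq S₂] in
theorem nonempty_isMinCurb [Nonempty S₁] [Nonempty S₂] :
    Nonempty {C : Finset S₁ × Finset S₂ // IsMinCurb u₁ u₂ k C} := by
  obtain ⟨C, -, hC⟩ := exists_isMinCurb_le u₁ u₂ k (E := (Finset.univ, Finset.univ))
    ⟨Finset.univ_nonempty, Finset.univ_nonempty, fun _ _ => Finset.subset_univ _,
      fun _ _ => Finset.subset_univ _⟩
  exact ⟨⟨C, hC⟩⟩

variable {u₁ u₂ k}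

omit [DecidableEq S₁] [DecidableEq S₂] in
theorem potential_le {C : Finset S₁ × Finset S₂} (hC : IsMinCurb u₁ u₂ k C) (M : ℝ)
    (p : State S₁ S₂) : potential u₁ u₂ k M p ≤ min 1 (M * outsideMass C p) :=
  ciInf_le (Set.finite_range _).bddBelow
    (⟨C, hC⟩ : {C : Finset S₁ × Finset S₂ // IsMinCurb u₁ u₂ k C})

variable [Nonempty S₁] [Nonempty S₂]

variable (u₁ u₂ k)

omit [DecidableEq S₁] [DecidableEq S₂] in
theorem exists_potential_eq (M : ℝ) (p : State S₁ S₂) :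
    ∃ C, IsMinCurb u₁ u₂ k C ∧ potential u₁ u₂ k M p = min 1 (M * outsideMass C p) := by
  have := nonempty_isMinCurb u₁ u₂ k
  obtain ⟨C, hC⟩ := exists_eq_ciInf_of_finite
    (f := fun C : {C : Finset S₁ × Finset S₂ // IsMinCurb u₁ u₂ k C} =>
      min 1 (M * outsideMass C.1 p))
  exact ⟨C.1, C.2, hC.symm⟩

omit [DecidableEq S₁] [DecidableEq S₂] in
theorem potential_le_one (M : ℝ) (p : State S₁ S₂) : potential u₁ u₂ k M p ≤ 1 := by
  obtain ⟨C, -, h⟩ := exists_potential_eq u₁ u₂ k M p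
  exact h.trans_le (min_le_left _ _)

omit [DecidableEq S₁] [DecidableEq S₂] in
theorem potential_nonneg {M : ℝ} (hM : 0 ≤ M) (p : State S₁ S₂) :
    0 ≤ potential u₁ u₂ k M p := by
  obtain ⟨C, -, h⟩ := exists_potential_eq u₁ u₂ k M p
  rw [h]
  exact le_min zero_le_one (mul_nonneg hM (outsideMass_nonneg C p))

omit [DecidableEq S₁] [DecidableEq S₂] in
theorem continuous_potential (M : ℝ) : Continuous (potential u₁ u₂ k M) := by
  classical
  have := nonempty_isMinCurb u₁ u₂ k
  have h : potential u₁ u₂ k M = fun p => Finset.univ.inf' Finset.univ_nonempty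
      fun C : {C : Finset S₁ × Finset S₂ // IsMinCurb u₁ u₂ k C} =>
        min 1 (M * outsideMass C.1 p) := by
    funext p
    rw [Finset.inf'_univ_eq_ciInf]
    rfl
  rw [h]
  exact Continuous.finset_inf'_apply _ fun C _ =>
    continuous_const.min (continuous_const.mul (continuous_outsideMass C.1))

theorem isWeight_jointProb_zero : IsWeight (jointProb u₁ u₂ k 0) :=
  isWeight_jointProb u₁ u₂ k ⟨le_rfl, zero_le_one⟩

/-! ### Drift of the potential under the unperturbed chain. -/

variable {u₁ u₂ k}

/-- Play inside `C` multiplies the outside mass by `β`. Play outside has probability at most `k *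
outsideMass C p`, and there the cap `1` bounds the function; this is why the potential is capped. -/
theorem samplerOp_min_outsideMass_le {C : Finset S₁ × Finset S₂} (hC : IsCurb u₁ u₂ k C) {M : ℝ}
    (hM : 0 ≤ M) (p : State S₁ S₂) :
    samplerOp u₁ u₂ k β 0 (fun p => min 1 (M * outsideMass C p)) p ≤
      (β * M + k) * outsideMass C p := by
  classical
  have hq := isWeight_jointProb_zero u₁ u₂ k
  have hQ : 1 - k * outsideMass C p ≤ ∑ s ∈ C.1 ×ˢ C.2, jointProb u₁ u₂ k 0 s p := by
    have h1 := one_sub_mul_le_sum_bestReplyProb u₁ k p.2 hC.2.2.1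
    have h2 := one_sub_mul_le_sum_bestReplyProb u₂ k p.1 hC.2.2.2
    have h1' : ∑ a ∈ C.1, bestReplyProb u₁ k p.2 a ≤ 1 := by
      rw [← sum_bestReplyProb u₁ k p.2]
      exact Finset.sum_le_univ_sum_of_nonneg fun a => bestReplyProb_nonneg u₁ k p.2 a
    have h2' : ∑ a ∈ C.2, bestReplyProb u₂ k p.1 a ≤ 1 := by
      rw [← sum_bestReplyProb u₂ k p.1]
      exact Finset.sum_le_univ_sum_of_nonneg fun a => bestReplyProb_nonneg u₂ k p.1 a
    rw [Finset.sum_product]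
    simp only [jointProb, playProb_zero, ← Finset.mul_sum, ← Finset.sum_mul]
    -- For numbers `x, y ≤ 1` this gives `x * y ≥ x + y - 1`, so the losses of the two players add
    -- up.
    have h3 := mul_nonneg (sub_nonneg.2 h1') (sub_nonneg.2 h2')
    unfold outsideMass
    linarith
  have hle : ∀ s, jointProb u₁ u₂ k 0 s p * min 1 (M * outsideMass C (jointUpdate β s p)) ≤
      jointProb u₁ u₂ k 0 s p * (β * M * outsideMass C p) +
        if s ∈ C.1 ×ˢ C.2 then 0 else jointProb u₁ u₂ k 0 s p := by
    intro s
    have h0 := hq.nonneg s p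
    split_ifs with hs
    · rw [Finset.mem_product] at hs
      rw [outsideMass_jointUpdate β hs.1 hs.2, add_zero]
      exact mul_le_mul_of_nonneg_left ((min_le_right _ _).trans_eq (by ring)) h0
    · have h1 : 0 ≤ jointProb u₁ u₂ k 0 s p * (β * M * outsideMass C p) :=
        mul_nonneg h0 (mul_nonneg (mul_nonneg β.2.1 hM) (outsideMass_nonneg C p))
      exact (mul_le_of_le_one_right h0 (min_le_left _ _)).trans (le_add_of_nonneg_left h1)
  refine (Finset.sum_le_sum fun s _ => hle s).trans ?_
  rw [Finset.sum_add_distrib, ← Finset.sum_mul, hq.sum_eq_one, one_mul]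
  have hsplit : ∑ s ∈ C.1 ×ˢ C.2, jointProb u₁ u₂ k 0 s p +
      ∑ s, (if s ∈ C.1 ×ˢ C.2 then 0 else jointProb u₁ u₂ k 0 s p) = 1 := by
    rw [← hq.sum_eq_one p, ← Finset.univ_inter (C.1 ×ˢ C.2), ← Finset.sum_ite_mem,
      ← Finset.sum_add_distrib]
    exact Finset.sum_congr rfl fun s _ => by split_ifs <;> simp_all
  linarith

/-- The block `C` nearest to `p` serves as a competitor in the infimum after the step. Where the cap
is not active, the drift bound for `C` is the contraction. -/
theorem samplerOp_potential_le {M γ : ℝ} (hM : 0 ≤ M) (hγ : β * M + k ≤ γ * M)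
    (hγ1 : γ ≤ 1) (p : State S₁ S₂) :
    samplerOp u₁ u₂ k β 0 (potential u₁ u₂ k M) p ≤ potential u₁ u₂ k M p ∧
      (potential u₁ u₂ k M p < 1 →
        samplerOp u₁ u₂ k β 0 (potential u₁ u₂ k M) p ≤ γ * potential u₁ u₂ k M p) := by
  have hq := isWeight_jointProb_zero u₁ u₂ k
  obtain ⟨C, hC, hp⟩ := exists_potential_eq u₁ u₂ k M p
  have h1 : samplerOp u₁ u₂ k β 0 (potential u₁ u₂ k M) p ≤ γ * (M * outsideMass C p) :=
    ((markovOp_mono hq (fun p => potential_le hC M p) p).trans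
      (samplerOp_min_outsideMass_le β hC.prop hM p)).trans
      ((mul_le_mul_of_nonneg_right hγ (outsideMass_nonneg C p)).trans_eq (mul_assoc _ _ _))
  have h2 : samplerOp u₁ u₂ k β 0 (potential u₁ u₂ k M) p ≤ 1 :=
    (markovOp_mono hq (potential_le_one u₁ u₂ k M) p).trans_eq (markovOp_const hq 1 p)
  have h0 : 0 ≤ M * outsideMass C p := mul_nonneg hM (outsideMass_nonneg C p)
  constructor
  · rw [hp]
    exact le_min h2 (h1.trans (mul_le_of_le_one_left h0 hγ1))
  · intro hlt
    rw [hp] at hlt ⊢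
    rwa [min_eq_right ((min_lt_iff.1 hlt).resolve_left (lt_irrefl _)).le]

/-! ### Reaching a minimal CURB block with probability bounded below. -/

theorem samplerOp_iterate_le_one {f : State S₁ S₂ → ℝ} (hf : ∀ p, f p ≤ 1) (n : ℕ)
    (p : State S₁ S₂) : (samplerOp u₁ u₂ k β 0)^[n] f p ≤ 1 := by
  have hq := isWeight_jointProb_zero u₁ u₂ k
  induction n generalizing p with
  | zero => exact hf p
  | succ n ih =>
    rw [Function.iterate_succ_apply']
    exact (markovOp_mono hq ih p).trans_eq (markovOp_const hq 1 p)

/-- This allows bounds obtained after different numbers of steps to be moved to one common later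
time. -/
theorem antitone_samplerOp_iterate {f : State S₁ S₂ → ℝ}
    (hf : ∀ p, samplerOp u₁ u₂ k β 0 f p ≤ f p) (p : State S₁ S₂) :
    Antitone fun n => (samplerOp u₁ u₂ k β 0)^[n] f p :=
  antitone_nat_of_succ_le fun n => by
    rw [Function.iterate_succ_apply]
    exact markovOp_iterate_mono (isWeight_jointProb_zero u₁ u₂ k) hf n p

/-- If both components of `p` have substantial weight in a CURB block, then the unperturbed chain
may move towards the block for as long as we like. -/
theorem samplerOp_iterate_potential_le_of_isMinCurb {C : Finset S₁ × Finset S₂}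
    (hC : IsMinCurb u₁ u₂ k C) {M : ℝ} (hM : 0 ≤ M) {c : ℝ} (hc : 0 ≤ c) (n : ℕ) :
    ∀ (p : State S₁ S₂) (r : ℝ), outsideMass C p ≤ r → c ≤ ∑ s ∈ C.1, p.1.1 s →
      c ≤ ∑ s ∈ C.2, p.2.1 s →
      (samplerOp u₁ u₂ k β 0)^[n] (potential u₁ u₂ k M) p ≤
        1 - ((c / Fintype.card S₂) ^ k / Fintype.card S₁ *
          ((c / Fintype.card S₁) ^ k / Fintype.card S₂)) ^ n * (1 - M * β ^ n * r) := by
  have hq := isWeight_jointProb_zero u₁ u₂ k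
  induction n with
  | zero =>
    intro p r hr _ _
    have := ((potential_le hC M p).trans (min_le_right _ _)).trans
      (mul_le_mul_of_nonneg_left hr hM)
    simpa using this
  | succ n ih =>
    intro p r hr h₁ h₂
    -- Play inside `C` never lowers the total weight of the block, but a single action may lose its
    -- weight. Hence a heavy action is chosen anew at each step, and the constant sample of it has a
    -- best reply in `C`.
    obtain ⟨a₁, ha₁, hpa₁⟩ := exists_div_card_le hC.prop.1 hc h₁
    obtain ⟨a₂, ha₂, hpa₂⟩ := exists_div_card_le hC.prop.2.1 hc h₂
    obtain ⟨σ₂, hσ₂, s₁, hs₁, hps₁⟩ :=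
      exists_pow_div_card_le_bestReplyProb u₁ k p.2 (by positivity) hpa₂ ha₂
    obtain ⟨σ₁, hσ₁, s₂, hs₂, hps₂⟩ :=
      exists_pow_div_card_le_bestReplyProb u₂ k p.1 (by positivity) hpa₁ ha₁
    have hs₁C : s₁ ∈ C.1 := hC.prop.2.2.1 _ hσ₂ hs₁
    have hs₂C : s₂ ∈ C.2 := hC.prop.2.2.2 _ hσ₁ hs₂
    rw [Function.iterate_succ_apply', pow_succ', mul_assoc]
    refine markovOp_le_one_sub (i := (s₁, s₂)) hq (samplerOp_iterate_le_one β
      (potential_le_one u₁ u₂ k M) n) (by positivity) ?_ ((ih _ (β * r) ?_ ?_ ?_).trans_eq ?_)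
    · simp only [jointProb, playProb_zero]
      exact mul_le_mul hps₁ hps₂ (by positivity) (bestReplyProb_nonneg _ _ _ _)
    · rw [outsideMass_jointUpdate β hs₁C hs₂C]
      exact mul_le_mul_of_nonneg_left hr β.2.1
    · have h3 := one_sub_sum_update β p.1 hs₁C
      have h4 := mul_le_of_le_one_left (one_sub_sum_nonneg p.1 C.1) β.2.2
      change c ≤ ∑ s ∈ C.1, (update β p.1 s₁).1 s
      linarith
    · have h3 := one_sub_sum_update β p.2 hs₂C
      have h4 := mul_le_of_le_one_left (one_sub_sum_nonneg p.2 C.2) β.2.2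
      change c ≤ ∑ s ∈ C.2, (update β p.2 s₂).1 s
      linarith
    · ring

/-- If every action of the block `E` has substantial weight, then the unperturbed chain may come
close to a minimal CURB block: best replies to samples from `E` enlarge `E` until it is a CURB
block. -/
theorem exists_samplerOp_iterate_potential_le (hk : 1 ≤ k) (hβ0 : 0 < (β : ℝ)) (hβ1 : (β : ℝ) < 1)
    {M : ℝ} (hM : 0 ≤ M) (E : Finset S₁ × Finset S₂) (hE₁ : E.1.Nonempty) (hE₂ : E.2.Nonempty)
    {c : ℝ} (hc : 0 < c) :
    ∃ (N : ℕ) (η : ℝ), 0 < η ∧ ∀ p : State S₁ S₂, (∀ a ∈ E.1, c ≤ p.1.1 a) →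
      (∀ a ∈ E.2, c ≤ p.2.1 a) →
      (samplerOp u₁ u₂ k β 0)^[N] (potential u₁ u₂ k M) p ≤ 1 - η := by
  have hq := isWeight_jointProb_zero u₁ u₂ k
  have hm₁ : (0 : ℝ) < Fintype.card S₁ := by exact_mod_cast Fintype.card_pos
  have hm₂ : (0 : ℝ) < Fintype.card S₂ := by exact_mod_cast Fintype.card_pos
  induction hn : E.1ᶜ.card + E.2ᶜ.card using Nat.strong_induction_on generalizing E c with
  | _ n ih =>
  subst hn
  by_cases hcurb : IsCurb u₁ u₂ k E
  · obtain ⟨C, hCE, hC⟩ := exists_isMinCurb_le u₁ u₂ k hcurb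
    -- The outside mass is at most `2`; after `n` moves inside `C` the potential is at most `1 / 2`.
    obtain ⟨n, hn⟩ : ∃ n : ℕ, M * (β : ℝ) ^ n * 2 ≤ 1 / 2 := by
      have : Tendsto (fun n : ℕ => M * (β : ℝ) ^ n * 2) atTop (𝓝 0) := by
        simpa using ((tendsto_pow_atTop_nhds_zero_of_lt_one hβ0.le hβ1).const_mul M).mul_const 2
      exact (this.eventually_le_const (by norm_num)).exists
    set κ : ℝ := (c / Fintype.card S₂) ^ k / Fintype.card S₁ *
          ((c / Fintype.card S₁) ^ k / Fintype.card S₂) with hκ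
    have hκ0 : 0 < κ := by positivity
    refine ⟨n, κ ^ n * (1 / 2), by positivity, fun p h₁ h₂ => ?_⟩
    obtain ⟨a₁, ha₁⟩ := hC.prop.1
    obtain ⟨a₂, ha₂⟩ := hC.prop.2.1
    refine (samplerOp_iterate_potential_le_of_isMinCurb β hC hM hc.le n p 2
      (outsideMass_le_two C p)
      ((h₁ a₁ (hCE.1 ha₁)).trans (Finset.single_le_sum (fun s _ => p.1.2.1 s) ha₁))
      ((h₂ a₂ (hCE.2 ha₂)).trans (Finset.single_le_sum (fun s _ => p.2.2.1 s) ha₂))).trans ?_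
    have := mul_le_mul_of_nonneg_left (show 1 / 2 ≤ 1 - M * (β : ℝ) ^ n * 2 by linarith)
      (pow_pos hκ0 n).le
    linarith
  -- After one update, old actions keep at least `β * c`, and the action just played has at least `1
  -- - β`.
  · set c' : ℝ := min (β * c) (1 - β) with hc'
    have hc'0 : 0 < c' := lt_min (by positivity) (by linarith)
    have hκ0 : 0 < c ^ k / Fintype.card S₁ * (c ^ k / Fintype.card S₂) := by positivity
    have hstep : ∀ (N : ℕ) (η : ℝ) (p : State S₁ S₂) (s₁ : S₁) (s₂ : S₂),
        c ^ k / Fintype.card S₁ ≤ bestReplyProb u₁ k p.2 s₁ →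
        c ^ k / Fintype.card S₂ ≤ bestReplyProb u₂ k p.1 s₂ →
        (samplerOp u₁ u₂ k β 0)^[N] (potential u₁ u₂ k M) (jointUpdate β (s₁, s₂) p) ≤ 1 - η →
        (samplerOp u₁ u₂ k β 0)^[N + 1] (potential u₁ u₂ k M) p ≤
          1 - c ^ k / Fintype.card S₁ * (c ^ k / Fintype.card S₂) * η := by
      intro N η p s₁ s₂ h₁ h₂ h
      rw [Function.iterate_succ_apply']
      refine markovOp_le_one_sub (i := (s₁, s₂)) hq
        (samplerOp_iterate_le_one β (potential_le_one u₁ u₂ k M) N) hκ0.le ?_ h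
      simp only [jointProb, playProb_zero]
      exact mul_le_mul h₁ h₂ (by positivity) (bestReplyProb_nonneg _ _ _ _)
    have hcases : (∃ σ ∈ lattice k E.2, ¬ bestReplies u₁ σ ⊆ E.1) ∨
        ∃ σ ∈ lattice k E.1, ¬ bestReplies u₂ σ ⊆ E.2 := by
      by_contra! h
      exact hcurb ⟨hE₁, hE₂, h.1, h.2⟩
    obtain ⟨e₁, he₁⟩ := hE₁
    obtain ⟨e₂, he₂⟩ := hE₂
    rcases hcases with ⟨σ, hσ, hsub⟩ | ⟨σ, hσ, hsub⟩
    · obtain ⟨ω, hω, rfl⟩ := exists_empirical_eq hk hσ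
      obtain ⟨a, ha, haE⟩ := Finset.not_subset.1 hsub
      obtain ⟨N, η, hη, hN⟩ := ih ((insert a E.1)ᶜ.card + E.2ᶜ.card)
        (Nat.add_lt_add_right (Finset.card_lt_card
          (Finset.compl_ssubset_compl.2 (Finset.ssubset_insert haE))) _)
        (insert a E.1, E.2) (Finset.insert_nonempty _ _) ⟨e₂, he₂⟩ hc'0 rfl
      refine ⟨N + 1, _, mul_pos hκ0 hη, fun p h₁ h₂ => ?_⟩
      -- Only player 1 enlarges her set. Player 2 plays some best reply `b` to a constant sample; it
      -- may lie outside `E.2` and is simply not recorded.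
      obtain ⟨-, -, b, -, hb⟩ :=
        exists_pow_div_card_le_bestReplyProb u₂ k p.1 hc.le (h₁ e₁ he₁) he₁
      exact hstep N η p a b
        (pow_div_card_le_bestReplyProb u₁ p.2 hc.le (fun j => h₂ _ (hω j)) ha) hb
        (hN _ (fun x hx => min_le_update_of_mem_insert β h₁ a hx)
          fun x hx => min_le_update_of_mem_insert β h₂ b (Finset.mem_insert_of_mem hx))
    · obtain ⟨ω, hω, rfl⟩ := exists_empirical_eq hk hσ
      obtain ⟨b, hb, hbE⟩ := Finset.not_subset.1 hsub
      obtain ⟨N, η, hη, hN⟩ := ih (E.1ᶜ.card + (insert b E.2)ᶜ.card)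
        (Nat.add_lt_add_left (Finset.card_lt_card
          (Finset.compl_ssubset_compl.2 (Finset.ssubset_insert hbE))) _)
        (E.1, insert b E.2) ⟨e₁, he₁⟩ (Finset.insert_nonempty _ _) hc'0 rfl
      refine ⟨N + 1, _, mul_pos hκ0 hη, fun p h₁ h₂ => ?_⟩
      obtain ⟨-, -, a, -, ha⟩ :=
        exists_pow_div_card_le_bestReplyProb u₁ k p.2 hc.le (h₂ e₂ he₂) he₂
      exact hstep N η p a b ha
        (pow_div_card_le_bestReplyProb u₂ p.1 hc.le (fun j => h₁ _ (hω j)) hb)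
        (hN _ (fun x hx => min_le_update_of_mem_insert β h₁ a (Finset.mem_insert_of_mem hx))
          fun x hx => min_le_update_of_mem_insert β h₂ b hx)

/-- The iterates of the potential under the unperturbed chain decay uniformly. -/
theorem exists_samplerOp_iterate_potential_le_mul (hk : 1 ≤ k) (hβ0 : 0 < (β : ℝ))
    (hβ1 : (β : ℝ) < 1) {M γ : ℝ} (hM : 0 ≤ M) (hγ : β * M + k ≤ γ * M) (hγ1 : γ < 1) :
    ∃ (N : ℕ) (θ : ℝ), θ < 1 ∧ ∀ p : State S₁ S₂,
      (samplerOp u₁ u₂ k β 0)^[N] (potential u₁ u₂ k M) p ≤ θ * potential u₁ u₂ k M p := by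
  have hm₁ : (0 : ℝ) < Fintype.card S₁ := by exact_mod_cast Fintype.card_pos
  have hm₂ : (0 : ℝ) < Fintype.card S₂ := by exact_mod_cast Fintype.card_pos
  have hsuper : ∀ p, samplerOp u₁ u₂ k β 0 (potential u₁ u₂ k M) p ≤ potential u₁ u₂ k M p :=
    fun p => (samplerOp_potential_le β hM hγ hγ1.le p).1
  have hc : 0 < min (1 / (Fintype.card S₁ : ℝ)) (1 / Fintype.card S₂) :=
    lt_min (by positivity) (by positivity)
  choose N η hη hN using fun a : S₁ × S₂ =>
    exists_samplerOp_iterate_potential_le (u₁ := u₁) (u₂ := u₂) β hk hβ0 hβ1 hM ({a.1}, {a.2})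
      (Finset.singleton_nonempty _) (Finset.singleton_nonempty _) hc
  obtain ⟨a₀, -, ha₀⟩ := Finset.exists_min_image Finset.univ η Finset.univ_nonempty
  -- The `+ 1` guarantees at least one step, which the case `V < 1` needs for its factor `γ`. The
  -- other case, `V = 1`, uses the smallest gain `η a₀` over all pairs of starting actions.
  refine ⟨Finset.univ.sup N + 1, max γ (1 - η a₀), max_lt hγ1 (by linarith [hη a₀]), fun p => ?_⟩
  have hanti := antitone_samplerOp_iterate β hsuper p
  have hp0 := potential_nonneg u₁ u₂ k hM p
  rcases (potential_le_one u₁ u₂ k M p).lt_or_eq with hlt | heq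
  · exact ((hanti (show 1 ≤ Finset.univ.sup N + 1 by omega)).trans
      ((samplerOp_potential_le β hM hγ hγ1.le p).2 hlt)).trans
      (mul_le_mul_of_nonneg_right (le_max_left _ _) hp0)
  · rw [heq, mul_one]
    obtain ⟨a₁, -, h₁⟩ := exists_div_card_le Finset.univ_nonempty zero_le_one p.1.2.2.ge
    obtain ⟨a₂, -, h₂⟩ := exists_div_card_le Finset.univ_nonempty zero_le_one p.2.2.2.ge
    have h3 := hN (a₁, a₂) p
      (by simpa only [Finset.mem_singleton, forall_eq] using (min_le_left _ _).trans h₁)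
      (by simpa only [Finset.mem_singleton, forall_eq] using (min_le_right _ _).trans h₂)
    refine ((hanti ((Finset.le_sup (Finset.mem_univ (a₁, a₂))).trans (Nat.le_succ _))).trans
      h3).trans (le_trans ?_ (le_max_right _ _))
    linarith [ha₀ (a₁, a₂) (Finset.mem_univ _)]

/-! ### Concentration of the invariant measures. -/

omit [DecidableEq S₁] [DecidableEq S₂] in
theorem mem_minCurbNhd_of_potential_lt {M δ : ℝ} (hM : 0 < M) {p : State S₁ S₂}
    (hp : potential u₁ u₂ k M p < min 1 (M * δ)) : p ∈ minCurbNhd u₁ u₂ k δ := by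
  obtain ⟨C, hC, h⟩ := exists_potential_eq u₁ u₂ k M p
  rw [h] at hp
  have hlt : outsideMass C p < δ := by
    rcases min_lt_iff.1 hp with h1 | h1
    · exact absurd (h1.trans_le (min_le_left _ _)) (lt_irrefl _)
    · exact lt_of_mul_lt_mul_left (h1.trans_le (min_le_right _ _)) hM.le
  have h1 := one_sub_sum_nonneg p.1 C.1
  have h2 := one_sub_sum_nonneg p.2 C.2
  unfold outsideMass at hlt
  refine Set.mem_biUnion (show C ∈ {C | IsMinCurb u₁ u₂ k C} from hC) ⟨?_, ?_⟩ <;> linarith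

/-- Invariance equates the integral of the potential with that of its `N`-th perturbed iterate,
which is at most `θ` times the former plus a multiple of `ε`. It matters that `M` and `R` do not
depend on `ε`. -/
theorem exists_integral_potential_le (hk : 1 ≤ k) (hβ0 : 0 < (β : ℝ)) (hβ1 : (β : ℝ) < 1) :
    ∃ M > 0, ∃ R : ℝ, ∀ ε ∈ Set.Icc (0 : ℝ) 1, ∀ μ : Measure (State S₁ S₂),
      IsProbabilityMeasure μ → (kernel u₁ u₂ k β ε).Invariant μ →
      ∫ p, potential u₁ u₂ k M p ∂μ ≤ R * ε := by
  have hk0 : (0 : ℝ) < k := by exact_mod_cast hk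
  have hβ' : 0 < 1 - (β : ℝ) := by linarith
  -- With `γ = (1 + β) / 2` this choice makes `β * M + k = γ * M`.
  set M : ℝ := 2 * k / (1 - β) with hMdef
  have hM : 0 < M := by positivity
  have hMβ : M * (1 - β) = 2 * k := div_mul_cancel₀ _ hβ'.ne'
  obtain ⟨N, θ, hθ, hN⟩ := exists_samplerOp_iterate_potential_le_mul (u₁ := u₁) (u₂ := u₂) β hk
    hβ0 hβ1 (γ := (1 + β) / 2) hM.le (by linarith) (by linarith)
  refine ⟨M, hM, N * (Fintype.card (S₁ × S₂) * 2) / (1 - θ), fun ε hε μ _ hμ => ?_⟩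
  have hcont := continuous_potential u₁ u₂ k M
  have hint : Integrable (potential u₁ u₂ k M) μ := integrable_of_continuous hcont
  have h1 := integral_markovOp_iterate_of_invariant (isWeight_jointProb u₁ u₂ k hε)
    (kernel_apply_eq_sum u₁ u₂ k β ε) (continuous_jointProb u₁ u₂ k hε)
    (continuous_jointUpdate β) hμ hcont N
  have hint' : Integrable ((samplerOp u₁ u₂ k β ε)^[N] (potential u₁ u₂ k M)) μ :=
    integrable_of_continuous (continuous_markovOp_iterate (continuous_jointProb u₁ u₂ k hε)
      (continuous_jointUpdate β) hcont N)
  have h2 := integral_mono hint'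
    ((hint.const_mul θ).add (integrable_const (N * (Fintype.card (S₁ × S₂) * (ε + ε)) : ℝ)))
    fun p => (samplerOp_iterate_le_add u₁ u₂ k β hε (potential_nonneg u₁ u₂ k hM.le)
      (potential_le_one u₁ u₂ k M) N p).trans (add_le_add_left (hN p) _)
  simp only [Pi.add_apply] at h2
  rw [integral_add (hint.const_mul θ) (integrable_const _), integral_const_mul, integral_const,
    probReal_univ, one_smul] at h2
  have h3 := h1.symm.trans_le h2
  rw [div_mul_eq_mul_div, le_div_iff₀ (by linarith)]
  linarith

theorem tendsto_minCurbNhd (hk : 1 ≤ k) (hβ0 : 0 < (β : ℝ)) (hβ1 : (β : ℝ) < 1)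
    {μ : ℝ → ProbabilityMeasure (State S₁ S₂)}
    (hμ : ∀ ε ∈ Set.Ioc (0 : ℝ) 1,
      (kernel u₁ u₂ k β ε).Invariant (μ ε : Measure (State S₁ S₂))) {δ : ℝ} (hδ : 0 < δ) :
    Tendsto (fun ε : ℝ => (μ ε : Measure (State S₁ S₂)) (minCurbNhd u₁ u₂ k δ)) (𝓝[>] 0)
      (𝓝 1) := by
  obtain ⟨M, hM, R, hR⟩ :=
    exists_integral_potential_le (u₁ := u₁) (u₂ := u₂) β hk hβ0 hβ1
  -- Below `t` the cap is inactive and the outside mass of the nearest block is less than `δ`;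
  -- Markov's inequality is applied at this level.
  set t : ℝ := min 1 (M * δ) with ht
  have ht0 : 0 < t := lt_min one_pos (mul_pos hM hδ)
  have hlow : ∀ ε ∈ Set.Ioc (0 : ℝ) 1, 1 - ENNReal.ofReal (R * ε / t) ≤
      (μ ε : Measure (State S₁ S₂)) (minCurbNhd u₁ u₂ k δ) := by
    intro ε hε
    have h1 := mul_meas_ge_le_integral_of_nonneg (μ := (μ ε : Measure (State S₁ S₂)))
      (.of_forall (potential_nonneg u₁ u₂ k hM.le))
      (integrable_of_continuous (continuous_potential u₁ u₂ k M)) t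
    have h2 : (μ ε : Measure (State S₁ S₂)).real {p | t ≤ potential u₁ u₂ k M p} ≤ R * ε / t := by
      rw [le_div_iff₀ ht0, mul_comm]
      exact h1.trans (hR ε (Set.Ioc_subset_Icc_self hε) _ inferInstance (hμ ε hε))
    have h3 : (μ ε : Measure (State S₁ S₂)) {p | t ≤ potential u₁ u₂ k M p} ≤
        ENNReal.ofReal (R * ε / t) := by
      rw [← ofReal_measureReal]
      exact ENNReal.ofReal_le_ofReal h2
    rw [tsub_le_iff_right, ← measure_univ (μ := (μ ε : Measure (State S₁ S₂)))]
    refine (measure_mono fun p _ => ?_).trans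
      ((measure_union_le _ {p | t ≤ potential u₁ u₂ k M p}).trans (add_le_add_right h3 _))
    exact (lt_or_ge (potential u₁ u₂ k M p) t).imp (mem_minCurbNhd_of_potential_lt hM) id
  have hlim : Tendsto (fun ε : ℝ => 1 - ENNReal.ofReal (R * ε / t)) (𝓝[>] 0) (𝓝 1) := by
    have hcont : Continuous fun ε : ℝ => R * ε / t := by fun_prop
    have h0 : Tendsto (fun ε : ℝ => ENNReal.ofReal (R * ε / t)) (𝓝[>] 0) (𝓝 0) := by
      have := (ENNReal.continuous_ofReal.comp hcont).tendsto 0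
      simp only [Function.comp_def, mul_zero, zero_div, ENNReal.ofReal_zero] at this
      exact this.mono_left nhdsWithin_le_nhds
    simpa using ENNReal.Tendsto.sub tendsto_const_nhds h0 (.inl ENNReal.one_ne_top)
  refine tendsto_of_tendsto_of_tendsto_of_le_of_le' hlim tendsto_const_nhds ?_
    (.of_forall fun ε => prob_le_one)
  filter_upwards [Ioc_mem_nhdsGT (zero_lt_one' ℝ)] with ε hε using hlow ε hε

end Lyapunov

end RWS

theorem theorem2 {S₁ S₂ : Type*} [Fintype S₁] [DecidableEq S₁] [Nonempty S₁]
    [Fintype S₂] [DecidableEq S₂] [Nonempty S₂]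
    (u₁ : S₁ → S₂ → ℝ) (u₂ : S₂ → S₁ → ℝ) (k : ℕ) (hk : 1 ≤ k) (β : unitInterval)
    (hβ : (β : ℝ) ∈ Set.Ioo
      (1 - 1 / ((max (Fintype.card S₁) (Fintype.card S₂) : ℕ) : ℝ)) 1) :
    ∃ μ : ℝ → MeasureTheory.ProbabilityMeasure (RWS.State S₁ S₂),
      (∀ ε ∈ Set.Ioc (0 : ℝ) 1, ∀ ν : MeasureTheory.ProbabilityMeasure (RWS.State S₁ S₂),
        ProbabilityTheory.Kernel.Invariant (RWS.kernel u₁ u₂ k β ε)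
          (ν : MeasureTheory.Measure (RWS.State S₁ S₂)) ↔ ν = μ ε) ∧
      ∀ δ : ℝ, 0 < δ →
        Filter.Tendsto
          (fun ε : ℝ => (μ ε : MeasureTheory.Measure (RWS.State S₁ S₂))
            (RWS.minCurbNhd u₁ u₂ k δ))
          (nhdsWithin 0 (Set.Ioi 0)) (nhds 1) := by
  -- The maximum is at least `1`, so the lower end of the interval for `β` is nonnegative.
  have hβ0 : (0 : ℝ) < β := by
    refine lt_of_le_of_lt (sub_nonneg.2 (div_le_one_of_le₀ ?_ (Nat.cast_nonneg _))) hβ.1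
    exact_mod_cast (Fintype.card_pos (α := S₁)).trans_le (le_max_left _ _)
  have hex : ∀ ε : ℝ, ∃ μ : ProbabilityMeasure (RWS.State S₁ S₂), ε ∈ Set.Ioc (0 : ℝ) 1 →
      ∀ ν : ProbabilityMeasure (RWS.State S₁ S₂),
        (RWS.kernel u₁ u₂ k β ε).Invariant (ν : Measure (RWS.State S₁ S₂)) ↔ ν = μ := by
    intro ε
    by_cases hε : ε ∈ Set.Ioc (0 : ℝ) 1
    · obtain ⟨μ, hμ⟩ := RWS.exists_forall_kernel_invariant_iff u₁ u₂ k β hβ.2 hε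
      exact ⟨μ, fun _ => hμ⟩
    -- For other `ε` the value of `μ` is irrelevant; the invariant measure for error probability `1`
    -- serves as a default.
    · obtain ⟨μ, -⟩ :=
        RWS.exists_forall_kernel_invariant_iff u₁ u₂ k β hβ.2 (Set.right_mem_Ioc.2 one_pos)
      exact ⟨μ, fun h => absurd h hε⟩
  choose μ hμ using hex
  exact ⟨μ, hμ, fun δ hδ => RWS.tendsto_minCurbNhd β hk hβ0 hβ.2
    (fun ε hε => (hμ ε hε (μ ε)).2 rfl) hδ⟩
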